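/- **Setting.** Let $\mathbb H$ be a real separable Hilbert space with inner product $\langle\cdot,\cdot\rangle$ and norm $\|\cdot\|$, and let $1\le K\le n$. Let $G_1^*,\dots,G_K^*$ be a partition of $[n]=\{1,\dots,n\}$ into non-empty sets, $\underline n=\min_k|G_k^*|$. Let $X_1,\dots,X_n$ be independent $\mathbb H$-valued random variables with finite second moment, where $X_i$ has law $P_k$ for $i\in G_k^*$; let $\mu_k=\mathbb E X_i$ and $\Sigma_k=\mathbb E[(X_i-\mu_k)\otimes(X_i-\mu_k)]$ for $i\in G^*_k$. For a positive semidefinite trace class operator $\Gamma$, a random variable $X$ with mean $\mu$ is sub-gaussian with respect to $\Gamma$ if for some $\alpha\ge 0$ $$\mathbb E\, e^{\langle z,X-\mu\rangle}\le e^{\alpha^2\langle\Gamma z,z\rangle/2}\qquad\text{for all } z\in\mathbb H,$$ and $\|X\|_{\psi_2,\Gamma}$ is the infimum of all such $\alpha$. Write $\|\cdot\|_{\rm op},\|\cdot\|_{\rm HS},\|\cdot\|_{\rm tr}$ for the operator, Hilbert–Schmidt and trace norms. Let $C_B>0$ and suppose that * each $\Sigma_k$ is positive semidefinite and trace class, and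 $\|\Sigma_1\|_{\rm tr}=\dots=\|\Sigma_K\|_{\rm tr}$; * for $i\in G_k^*$, $X_i$ is sub-gaussian with respect to $\Sigma_k$ and $L_i:=\|X_i\|_{\psi_2,\Sigma_k}\le L$; * for $i\in G_k^*$ and every integer $q\ge 3$, $\ \mathbb E\big|\|X_i-\mu_k\|^2-\mathbb E\|X_i-\mu_k\|^2\big|^q\le C_B\,q!\,L_i^{q-2}\|\Sigma_k\|_{\rm op}^{q-2}\|\Sigma_k\|_{\rm HS}^2$; * $\Sigma$ is a bounded operator such that $\Sigma-\Sigma_k$ is positive semidefinite for every $k$. Put $\Delta=\min_{k\ne l}\|\mu_k-\mu_l\|$ (with $\Delta=\infty$ if $K=1$) and $$\mathsf{SNR}^2=\min\Big\{\frac{\Delta^2}{L^2\|\Sigma\|_{\rm op}},\ \frac{\underline n\,\Delta^4}{L^4\|\Sigma\|_{\rm HS}^2}\Big\}\in[0,\infty],$$ where $\|\Sigma\|_{\rm HS}=\infty$ if $\Sigma$ is not Hilbert–Schmidt, $a/0=\infty$ for $a>0$, and $0/0=\infty/\infty=0\cdot\infty=0$. **Estimator.** Let $A=(\langle X_i,X_j\rangle)_{i,j=1}^n$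 and let $\hat Z$ be any maximizer of $\langle A,Z\rangle=\sum_{i,j}A_{ij}Z_{ij}$ over the real $n\times n$ matrices $Z$ with $Z^T=Z$, $Z\succeq0$, $\operatorname{tr}Z=K$, $Z\mathbf 1_n=\mathbf 1_n$ and all entries $Z_{ij}\ge0$. Round $\hat Z$ greedily: for $k=1,2,\dots$, as long as $[n]\setminus\bigcup_{l<k}\hat G_l$ is non-empty, let $j_k$ be its smallest element and $\hat G_k=\{i\in[n]:\hat Z_{j_ki}\ge\tfrac12\hat Z_{j_kj_k}\}$. Let $\hat K$ be the number of sets obtained when no index remains. **Claim.** For every $C_B>0$ there are constants $c_1,c_2,C>0$, depending on nothing but $C_B$, such that in the setting above, if $$\mathsf{SNR}^2\ \ge\ c_1\max\{n/\underline n,\ \log n\}\qquad\text{and}\qquad \underline n^2K\ \ge\ c_2\,n,$$ then for a suitable non-random relabelling of the true clusters $G_1^*,\dots,G_K^*$, $$\mathbb P\big(\hat K=K\ \text{ and }\ \hat G_k=G_k^*\ \text{ for all } k=1,\dots,K\big)\ \ge\ 1-Cn^{-2}.$$ If the event is not measurable, this means that it contains an event of at least this probability. -/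

import Mathlib

open MeasureTheory ProbabilityTheory
open scoped ENNReal

noncomputable section

namespace KMeansSDP

/-! ### Operators on a real Hilbert space -/

section Operators

variable {H : Type*} [NormedAddCommGroup H] [InnerProductSpace ℝ H] {ι : Type*}

/-- The trace norm `∑ⱼ ⟨T eⱼ, eⱼ⟩` of a positive operator `T`, computed in a complete orthonormal
system `e` (its value, possibly `∞`, does not depend on `e`). It is only used for positive `T`, for
which `(T* T)^{1/2} = T`. -/
def posTraceNorm (e : HilbertBasis ι ℝ H) (T : H →L[ℝ] H) : ℝ≥0∞ :=
  ∑' j, ENNReal.ofReal (inner ℝ (T (e j)) (e j))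

/-- `T` is self-adjoint, satisfies `⟨T z, z⟩ ≥ 0` for all `z`, and is trace class. -/
def IsPositiveTraceClass (e : HilbertBasis ι ℝ H) (T : H →L[ℝ] H) : Prop :=
  T.IsPositive ∧ posTraceNorm e T < ∞

/-- The squared Hilbert-Schmidt norm `∑ⱼ ‖T eⱼ‖²`; it is `∞` if `T` is not Hilbert-Schmidt. -/
def hsNormSq (e : HilbertBasis ι ℝ H) (T : H →L[ℝ] H) : ℝ≥0∞ :=
  ∑' j, ‖T (e j)‖ₑ ^ 2

end Operators

/-! ### Sub-gaussian random variables in a Hilbert space -/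

section SubGaussian

variable {H : Type*} [NormedAddCommGroup H] [InnerProductSpace ℝ H]
  {Ω : Type*} [MeasurableSpace Ω]

/-- `E exp⟨z, Z - E Z⟩ ≤ exp(α² ⟨Γ z, z⟩ / 2)` for all `z`. The left side is an integral of a
non-negative function with values in `[0, ∞]`, so the bound includes its finiteness. -/
def SubGaussianBound (P : Measure Ω) (Z : Ω → H) (Γ : H →L[ℝ] H) (α : ℝ) : Prop :=
  ∀ z : H, ∫⁻ ω, ENNReal.ofReal (Real.exp (inner ℝ z (Z ω - ∫ ω', Z ω' ∂P))) ∂P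
    ≤ ENNReal.ofReal (Real.exp (α ^ 2 * inner ℝ (Γ z) z / 2))

/-- `Z` is sub-gaussian with respect to `Γ`. -/
def IsSubGaussian (P : Measure Ω) (Z : Ω → H) (Γ : H →L[ℝ] H) : Prop :=
  ∃ α : ℝ, 0 ≤ α ∧ SubGaussianBound P Z Γ α

/-- The `ψ₂` norm of `Z` with respect to `Γ` (meaningful when `IsSubGaussian P Z Γ`). -/
def psi2Norm (P : Measure Ω) (Z : Ω → H) (Γ : H →L[ℝ] H) : ℝ :=
  sInf {α : ℝ | 0 ≤ α ∧ SubGaussianBound P Z Γ α}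

/-- The covariance operator `E[(Z - E Z) ⊗ (Z - E Z)]`. Mathlib's `covarianceOperator` of a law is
the uncentred second moment operator, hence it is applied to the law of `Z - E Z`. -/
def covOp [CompleteSpace H] [MeasurableSpace H] [BorelSpace H]
    (P : Measure Ω) (Z : Ω → H) : H →L[ℝ] H :=
  covarianceOperator (P.map fun ω => Z ω - ∫ ω', Z ω' ∂P)

/-- Bernstein condition with constant `C` on the squared norm of the centred variable
`δ = Z - E Z`, when the reference operator is the covariance operator `S` of `Z`:
`E |‖δ‖² - E ‖δ‖²|^q ≤ C q! ‖Z‖_{ψ₂,S}^{q-2} ‖S‖_op^{q-2} ‖S‖_HS²` for all `q ≥ 3`. -/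
def BernsteinSqNorm {ι : Type*} (e : HilbertBasis ι ℝ H) (C : ℝ)
    (P : Measure Ω) (Z : Ω → H) (S : H →L[ℝ] H) : Prop :=
  ∀ q : ℕ, 3 ≤ q →
    ∫⁻ ω, ENNReal.ofReal
        (|‖Z ω - ∫ ω', Z ω' ∂P‖ ^ 2 - ∫ ω'', ‖Z ω'' - ∫ ω', Z ω' ∂P‖ ^ 2 ∂P| ^ q) ∂P
      ≤ ENNReal.ofReal (C * (q.factorial : ℝ) * psi2Norm P Z S ^ (q - 2) * ‖S‖ ^ (q - 2))
        * hsNormSq e S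

end SubGaussian

/-! ### Clusters and the signal-to-noise ratio -/

/-- The cluster with label `k` of the partition of `[n]` given by the labelling `σ`. -/
def cluster {n K : ℕ} (σ : Fin n → Fin K) (k : Fin K) : Finset (Fin n) :=
  Finset.univ.filter fun i => σ i = k

/-- The minimal cluster size. -/
def minSize {n K : ℕ} (σ : Fin n → Fin K) : ℕ :=
  ⨅ k, (cluster σ k).card

/-- The minimal distance between two centres (`∞` if there is only one centre). -/
def separation {H : Type*} [NormedAddCommGroup H] {K : ℕ} (m : Fin K → H) : ℝ≥0∞ :=
  ⨅ (k : Fin K) (l : Fin K) (_ : k ≠ l), ‖m k - m l‖ₑ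

/-- The squared signal-to-noise ratio
`Δ² / (L² ‖Σ‖_op) ∧ nmin Δ⁴ / (L⁴ ‖Σ‖_HS²)`, with values in `[0, ∞]`
(a positive number divided by `0` is `∞`, and `0 / 0 = 0`). -/
def snrSq {H : Type*} [NormedAddCommGroup H] [InnerProductSpace ℝ H] {ι : Type*}
    (e : HilbertBasis ι ℝ H) (nmin : ℕ) (Δ : ℝ≥0∞) (L : ℝ) (Sig : H →L[ℝ] H) : ℝ≥0∞ :=
  min (Δ ^ 2 / (ENNReal.ofReal L ^ 2 * ‖Sig‖ₑ))
    ((nmin : ℝ≥0∞) * Δ ^ 4 / (ENNReal.ofReal L ^ 4 * hsNormSq e Sig))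

/-! ### The semidefinite program -/

/-- The feasible set: symmetric positive semidefinite matrices with trace `K`, row sums one
and non-negative entries. -/
def feasible (n K : ℕ) : Set (Matrix (Fin n) (Fin n) ℝ) :=
  {Z | Z.IsSymm ∧ Z.PosSemidef ∧ Z.trace = (K : ℝ) ∧ Z.mulVec (fun _ => 1) = (fun _ => 1) ∧
    ∀ i j, 0 ≤ Z i j}

/-- `Z` maximizes `⟨A, Z⟩ = ∑ᵢⱼ Aᵢⱼ Zᵢⱼ` over the feasible set. -/
def IsSDPSolution {n : ℕ} (K : ℕ) (A Z : Matrix (Fin n) (Fin n) ℝ) : Prop :=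
  Z ∈ feasible n K ∧ ∀ Z' ∈ feasible n K, ∑ i, ∑ j, A i j * Z' i j ≤ ∑ i, ∑ j, A i j * Z i j

/-! ### Greedy rounding -/

open Classical in
/-- The set of all indices `i` with `Z j i ≥ Z j j / 2`. -/
def roundBlock {n : ℕ} (Z : Matrix (Fin n) (Fin n) ℝ) (j : Fin n) : Finset (Fin n) :=
  Finset.univ.filter fun i => (1 / 2 : ℝ) * Z j j ≤ Z j i

/-- At most `t` steps of the greedy rounding, started with the set `R` of remaining indices: as long
as `R` is not empty, take its smallest index `j`, output the block of `j` and remove it from `R`. -/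
def roundSteps {n : ℕ} (Z : Matrix (Fin n) (Fin n) ℝ) : ℕ → Finset (Fin n) → List (Finset (Fin n))
  | 0, _ => []
  | t + 1, R =>
    if h : R.Nonempty then
      roundBlock Z (R.min' h) :: roundSteps Z t (R \ roundBlock Z (R.min' h))
    else []

/-- The list of estimated clusters `Ĝ₁, Ĝ₂, …` that the greedy rounding of `Z` outputs; its length
is the estimated number of clusters. When the diagonal of `Z` is non-negative, every step removes an
index, so that `n` steps exhaust `[n]` (see `mem_greedyRounding`). -/
def greedyRounding {n : ℕ} (Z : Matrix (Fin n) (Fin n) ℝ) : List (Finset (Fin n)) :=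
  roundSteps Z n Finset.univ

theorem mem_roundSteps {n : ℕ} (Z : Matrix (Fin n) (Fin n) ℝ) (hZ : ∀ i, 0 ≤ Z i i) :
    ∀ (t : ℕ) (R : Finset (Fin n)), R.card ≤ t → ∀ i ∈ R, ∃ G ∈ roundSteps Z t R, i ∈ G := by
  intro t
  induction t with
  | zero =>
    intro R hR i hi
    have : R = ∅ := Finset.card_eq_zero.mp (Nat.le_zero.mp hR)
    simp [this] at hi
  | succ t ih =>
    intro R hR i hi
    have h : R.Nonempty := ⟨i, hi⟩
    have hj : R.min' h ∈ roundBlock Z (R.min' h) := by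
      simp only [roundBlock, Finset.mem_filter, Finset.mem_univ, true_and]
      linarith [hZ (R.min' h)]
    simp only [roundSteps, dif_pos h]
    by_cases hb : i ∈ roundBlock Z (R.min' h)
    · exact ⟨_, by simp, hb⟩
    · have hlt : (R \ roundBlock Z (R.min' h)).card < R.card := by
        apply Finset.card_lt_card
        refine ⟨Finset.sdiff_subset, fun hsub => ?_⟩
        exact (Finset.mem_sdiff.mp (hsub (R.min'_mem h))).2 hj
      obtain ⟨G, hG, hiG⟩ := ih _ (by omega) i (Finset.mem_sdiff.mpr ⟨hi, hb⟩)
      exact ⟨G, List.mem_cons_of_mem _ hG, hiG⟩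

/-- The rounding only stops when no index remains. -/
theorem mem_greedyRounding {n : ℕ} (Z : Matrix (Fin n) (Fin n) ℝ) (hZ : ∀ i, 0 ≤ Z i i)
    (i : Fin n) : ∃ G ∈ greedyRounding Z, i ∈ G :=
  mem_roundSteps Z hZ n Finset.univ (by simp) i (Finset.mem_univ i)

/-- The greedy rounding of `Z` outputs exactly `K` sets, and the `k`-th one is `G k`. -/
def RoundsTo {n K : ℕ} (Z : Matrix (Fin n) (Fin n) ℝ) (G : Fin K → Finset (Fin n)) : Prop :=
  (greedyRounding Z).length = K ∧ ∀ k : Fin K, (greedyRounding Z)[(k : ℕ)]? = some (G k)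

/-- The (not necessarily measurable) event `E` contains an event of probability at least `p`. -/
def HoldsWithProb {Ω : Type*} [MeasurableSpace Ω] (P : Measure Ω) (p : ℝ) (E : Set Ω) : Prop :=
  ∃ F : Set Ω, MeasurableSet F ∧ F ⊆ E ∧ ENNReal.ofReal p ≤ P F

end KMeansSDP

end

noncomputable section

namespace KMeansSDP

/-! ### Greedy rounding of the normalized partnership matrix. -/

section Rounding

variable {n K : ℕ}

/-! Write `X i = m (σ i) + δ i` and `P = blockMatrix σ`. Rounding `P` returns the true clusters in
an order that depends on `σ` alone, so it suffices that, with high probability, `P` is the only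
solution of the program.

Deterministic half. Row sums, symmetry and trace of a feasible `Z` are prescribed, so up to a
constant the objective is minus a signal term plus `tr (W Z)`, where `W` is the Gram matrix of the
noise with a number `γ` subtracted on the diagonal (`sum_gram_mul_eq`). Subtracting `γ` is free only
if it is the same for all indices; as the covariances have equal traces, `γ = E‖δ i‖²` qualifies.
Everything is compared with `offMass`. Moving away from `P` costs at least `3/8 Δ²` of signal per
unit of `offMass`. The noise gains at most `6b + c` per unit (`abs_trace_mul_sub_le`): the parts of
`P - Z` that touch the range of `P` are paired with the entries of `W P`, of size at most `b`; the
remaining part is, up to sign, positive semidefinite of trace at most `offMass / minSize`, and is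
paired with the quadratic form of `W`. With `b = c = Δ²/32` the signal wins, which forces `offMass =
0` and `Z = P`.

Probabilistic half. The required bounds concern linear forms of the noise, its cluster averages, its
quadratic form on a net, and its squared norms. Linear forms need only Chernoff's bound. The
off-diagonal forms are decoupled by averaging over bipartitions of the indices; integrating out one
half leaves the exponential moment of `⟨T V, V⟩`, which an auxiliary gaussian vector reduces to
one-dimensional integrals (`lintegral_exp_quadratic_le`). The resulting tail
`measure_abs_chaos_ge_le` involves the operator and Hilbert-Schmidt norms of `T`, the two quantities
in the signal-to-noise ratio. Its lower bound `log n` pays for polynomially many events, and `n /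
minSize` for the `25 ^ n` pairs of net points. The squared norms follow from the Bernstein moments;
these carry a power of the `ψ₂` norm lower than the tail bounds use, which is harmless because `L ≥
1` unless all covariances vanish (`covOp_eq_zero_or_one_le`). -/

theorem mem_cluster {σ : Fin n → Fin K} {k : Fin K} {i : Fin n} : i ∈ cluster σ k ↔ σ i = k := by
  simp [cluster]

theorem card_cluster_pos {σ : Fin n → Fin K} (hσ : Function.Surjective σ) (k : Fin K) :
    0 < (cluster σ k).card := by
  obtain ⟨i, hi⟩ := hσ k
  exact Finset.card_pos.mpr ⟨i, mem_cluster.mpr hi⟩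

theorem minSize_le (σ : Fin n → Fin K) (k : Fin K) : minSize σ ≤ (cluster σ k).card :=
  ciInf_le (OrderBot.bddBelow _) k

theorem minSize_pos {σ : Fin n → Fin K} (hσ : Function.Surjective σ) (hK : 1 ≤ K) :
    0 < minSize σ := by
  have : Nonempty (Fin K) := ⟨⟨0, hK⟩⟩
  obtain ⟨k, hk⟩ := exists_eq_ciInf_of_finite (f := fun k => (cluster σ k).card)
  rw [minSize, ← hk]
  exact card_cluster_pos hσ k

/-- The normalized partnership matrix of the partition into the fibres of `σ`. -/
def blockMatrix (σ : Fin n → Fin K) : Matrix (Fin n) (Fin n) ℝ :=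
  Matrix.of fun i j => if σ i = σ j then ((cluster σ (σ i)).card : ℝ)⁻¹ else 0

theorem blockMatrix_apply (σ : Fin n → Fin K) (i j : Fin n) :
    blockMatrix σ i j = if σ i = σ j then ((cluster σ (σ i)).card : ℝ)⁻¹ else 0 := rfl

theorem card_cluster_inv_pos (σ : Fin n → Fin K) (i : Fin n) :
    0 < ((cluster σ (σ i)).card : ℝ)⁻¹ :=
  inv_pos.mpr (Nat.cast_pos.mpr (Finset.card_pos.mpr ⟨i, mem_cluster.mpr rfl⟩))

/-- Row `j` takes only the values `P j j > 0` and `0`, so the threshold `P j j / 2` separates them.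
-/
theorem roundBlock_blockMatrix (σ : Fin n → Fin K) (j : Fin n) :
    roundBlock (blockMatrix σ) j = cluster σ (σ j) := by
  ext i
  have h := card_cluster_inv_pos σ j
  simp only [roundBlock, Finset.mem_filter, Finset.mem_univ, true_and, blockMatrix_apply,
    mem_cluster, if_true]
  by_cases hij : σ j = σ i
  · simp only [hij, if_true, iff_true]
    rw [hij] at h
    linarith
  · simp only [hij, if_false]
    exact ⟨fun h' => absurd h' (by linarith), fun h' => absurd h'.symm hij⟩

/-- The invariant of the induction is that the remaining indices form a union of whole clusters,
with label set `s`; each step erases one label. -/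
theorem roundSteps_blockMatrix {σ : Fin n → Fin K} (hσ : Function.Surjective σ) :
    ∀ (t : ℕ) (R : Finset (Fin n)) (s : Finset (Fin K)), (∀ i, i ∈ R ↔ σ i ∈ s) → R.card ≤ t →
      ∃ l : List (Fin K), l.Nodup ∧ (∀ k, k ∈ l ↔ k ∈ s) ∧
        roundSteps (blockMatrix σ) t R = l.map (cluster σ) := by
  intro t
  induction t with
  | zero =>
    intro R s hRs hR
    have hR0 : R = ∅ := Finset.card_eq_zero.mp (Nat.le_zero.mp hR)
    refine ⟨[], List.nodup_nil, fun k => ?_, rfl⟩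
    obtain ⟨i, rfl⟩ := hσ k
    simp [← hRs i, hR0]
  | succ t ih =>
    intro R s hRs hR
    by_cases h : R.Nonempty
    · have hmem := R.min'_mem h
      obtain ⟨l, hl, hls, hlr⟩ := ih (R \ cluster σ (σ (R.min' h))) (s.erase (σ (R.min' h)))
        (fun i => by rw [Finset.mem_sdiff, mem_cluster, Finset.mem_erase, hRs]; tauto) (by
          have : (R \ cluster σ (σ (R.min' h))).card < R.card := by
            apply Finset.card_lt_card
            refine ⟨Finset.sdiff_subset, fun hsub => ?_⟩
            exact (Finset.mem_sdiff.mp (hsub hmem)).2 (mem_cluster.mpr rfl)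
          omega)
      refine ⟨σ (R.min' h) :: l, List.nodup_cons.mpr ⟨?_, hl⟩, fun k => ?_, ?_⟩
      · rw [hls]; simp
      · rw [List.mem_cons, hls, Finset.mem_erase]
        have := (hRs _).mp hmem
        by_cases hk : k = σ (R.min' h)
        · simp [hk, this]
        · simp [hk]
      · simp only [roundSteps, dif_pos h, roundBlock_blockMatrix, hlr, List.map_cons]
    · refine ⟨[], List.nodup_nil, fun k => ?_, by simp [roundSteps, h]⟩
      obtain ⟨i, rfl⟩ := hσ k
      simp [← hRs i, Finset.not_nonempty_iff_eq_empty.mp h]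

/-- The labels come out as a duplicate-free list of all of `Fin K`, that is, as a permutation. It is
non-random since only `σ` enters. -/
theorem exists_perm_roundsTo_blockMatrix {σ : Fin n → Fin K} (hσ : Function.Surjective σ) :
    ∃ π : Equiv.Perm (Fin K), RoundsTo (blockMatrix σ) fun k => cluster σ (π k) := by
  obtain ⟨l, hl, hls, hlr⟩ := roundSteps_blockMatrix hσ n Finset.univ Finset.univ
    (fun i => by simp) (by simp)
  have hmem : ∀ k, k ∈ l := fun k => (hls k).mpr (Finset.mem_univ k)
  have hlen : l.length = K := by
    have := Fintype.card_congr (hl.getEquivOfForallMemList l hmem)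
    simpa using this
  refine ⟨(finCongr hlen.symm).trans (hl.getEquivOfForallMemList l hmem), ?_, fun k => ?_⟩
  · rw [greedyRounding, hlr, List.length_map, hlen]
  · rw [greedyRounding, hlr]
    simp [hlen]

end Rounding

/-! ### Feasible matrices compared with the block matrix through their off-cluster mass. -/

section BlockMatrix

open Matrix

variable {n K : ℕ} (σ : Fin n → Fin K)

theorem blockMatrix_nonneg (i j : Fin n) : 0 ≤ blockMatrix σ i j := by
  rw [blockMatrix_apply]
  split_ifs
  · exact (card_cluster_inv_pos σ i).le
  · exact le_rfl

theorem blockMatrix_symm (i j : Fin n) : blockMatrix σ i j = blockMatrix σ j i := by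
  rw [blockMatrix_apply, blockMatrix_apply]
  by_cases h : σ i = σ j
  · simp [h]
  · simp [h, Ne.symm h]

theorem blockMatrix_transpose : (blockMatrix σ)ᵀ = blockMatrix σ := by
  ext i j
  exact blockMatrix_symm σ j i

theorem sum_blockMatrix (i : Fin n) : ∑ j, blockMatrix σ i j = 1 := by
  simp only [blockMatrix_apply]
  rw [← Finset.sum_filter, Finset.sum_const, nsmul_eq_mul]
  have : (Finset.univ.filter fun j => σ i = σ j) = cluster σ (σ i) := by
    ext j; simp [mem_cluster, eq_comm]
  rw [this]
  exact mul_inv_cancel₀ (inv_pos.mp (card_cluster_inv_pos σ i)).ne'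

/-- Where `P i l ≠ 0`, rows `i` and `l` coincide. With unit row sums this makes `P` a projection. -/
theorem blockMatrix_apply_mul_apply (i l j : Fin n) :
    blockMatrix σ i l * blockMatrix σ l j = blockMatrix σ i l * blockMatrix σ i j := by
  simp only [blockMatrix_apply]
  by_cases h : σ i = σ l
  · simp [h]
  · simp [h]

theorem blockMatrix_mul_self : blockMatrix σ * blockMatrix σ = blockMatrix σ := by
  ext i j
  simp only [mul_apply, blockMatrix_apply_mul_apply]
  rw [← Finset.sum_mul, sum_blockMatrix, one_mul]

variable {σ} in
theorem trace_blockMatrix (hσ : Function.Surjective σ) : (blockMatrix σ).trace = K := by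
  simp only [trace, diag, blockMatrix_apply, if_true]
  rw [← Finset.sum_fiberwise (s := Finset.univ) (g := σ)]
  have : ∀ k : Fin K, ∑ i with σ i = k, ((cluster σ (σ i)).card : ℝ)⁻¹ = 1 := by
    intro k
    rw [Finset.sum_congr rfl (g := fun _ => ((cluster σ k).card : ℝ)⁻¹)
      (fun i hi => by rw [(Finset.mem_filter.mp hi).2])]
    rw [Finset.sum_const, nsmul_eq_mul]
    exact mul_inv_cancel₀ (Nat.cast_ne_zero.mpr (card_cluster_pos hσ k).ne')
  simp [this]

variable {σ} in
theorem blockMatrix_mem_feasible (hσ : Function.Surjective σ) : blockMatrix σ ∈ feasible n K := by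
  refine ⟨blockMatrix_transpose σ, ?_, trace_blockMatrix hσ, ?_, blockMatrix_nonneg σ⟩
  · have := posSemidef_conjTranspose_mul_self (blockMatrix σ)
    rwa [conjTranspose_eq_transpose_of_trivial, blockMatrix_transpose, blockMatrix_mul_self] at this
  · ext i
    simp [mulVec, dotProduct, sum_blockMatrix]

/-- The mass that `Z` puts on pairs of indices in different clusters. -/
def offMass (Z : Matrix (Fin n) (Fin n) ℝ) : ℝ :=
  ∑ i, ∑ j, if σ i = σ j then 0 else Z i j

variable {Z : Matrix (Fin n) (Fin n) ℝ}

theorem offMass_nonneg (hZ : Z ∈ feasible n K) : 0 ≤ offMass σ Z :=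
  Finset.sum_nonneg fun i _ => Finset.sum_nonneg fun j _ => by
    split_ifs
    · exact le_rfl
    · exact hZ.2.2.2.2 i j

theorem sum_row_of_mem_feasible (hZ : Z ∈ feasible n K) (i : Fin n) : ∑ j, Z i j = 1 := by
  have := congr_fun hZ.2.2.2.1 i
  simpa [mulVec, dotProduct] using this

theorem symm_of_mem_feasible (hZ : Z ∈ feasible n K) (i j : Fin n) : Z i j = Z j i :=
  hZ.1.apply j i

theorem sum_col_of_mem_feasible (hZ : Z ∈ feasible n K) (j : Fin n) : ∑ i, Z i j = 1 := by
  rw [← sum_row_of_mem_feasible hZ j]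
  exact Finset.sum_congr rfl fun i _ => symm_of_mem_feasible hZ i j

/-- Since column `j` of `Z` sums to one, `P i j` can be spread over `l` with weights `Z l j`; the
terms with `l` in the cluster of `j` then cancel. -/
theorem blockMatrix_sub_apply (hZ : Z ∈ feasible n K) (i j : Fin n) :
    |(blockMatrix σ * (blockMatrix σ - Z)) i j| ≤
      blockMatrix σ i j * (∑ l, if σ l = σ j then 0 else Z l j)
        + ∑ l, blockMatrix σ i l * (if σ l = σ j then 0 else Z l j) := by
  have hnn : ∀ l, 0 ≤ if σ l = σ j then 0 else Z l j := fun l => by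
    split_ifs
    · exact le_rfl
    · exact hZ.2.2.2.2 l j
  have e : (blockMatrix σ * (blockMatrix σ - Z)) i j
      = blockMatrix σ i j * (∑ l, if σ l = σ j then 0 else Z l j)
        - ∑ l, blockMatrix σ i l * (if σ l = σ j then 0 else Z l j) := by
    rw [Matrix.mul_sub, blockMatrix_mul_self, Matrix.sub_apply, mul_apply]
    have h1 : blockMatrix σ i j = ∑ l, blockMatrix σ i j * Z l j := by
      rw [← Finset.mul_sum, sum_col_of_mem_feasible hZ, mul_one]
    conv_lhs => rw [h1]
    rw [Finset.mul_sum, ← Finset.sum_sub_distrib, ← Finset.sum_sub_distrib]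
    refine Finset.sum_congr rfl fun l _ => ?_
    by_cases hl : σ l = σ j
    · simp [blockMatrix_apply, hl]
    · simp [hl]
  rw [e]
  refine (abs_sub _ _).trans (add_le_add (abs_of_nonneg ?_).le (abs_of_nonneg ?_).le)
  · exact mul_nonneg (blockMatrix_nonneg σ i j) (Finset.sum_nonneg fun l _ => hnn l)
  · exact Finset.sum_nonneg fun l _ => mul_nonneg (blockMatrix_nonneg σ i l) (hnn l)

theorem sum_abs_blockMatrix_mul_sub_le (hZ : Z ∈ feasible n K) :
    ∑ i, ∑ j, |(blockMatrix σ * (blockMatrix σ - Z)) i j| ≤ 2 * offMass σ Z := by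
  have hcol : ∀ j, ∑ i, blockMatrix σ i j = 1 := fun j => by
    rw [← sum_blockMatrix σ j]
    exact Finset.sum_congr rfl fun i _ => blockMatrix_symm σ i j
  have hT : ∑ j, ∑ l, (if σ l = σ j then 0 else Z l j) = offMass σ Z := by
    rw [offMass, Finset.sum_comm]
  calc ∑ i, ∑ j, |(blockMatrix σ * (blockMatrix σ - Z)) i j|
      ≤ ∑ i, ∑ j, (blockMatrix σ i j * (∑ l, if σ l = σ j then 0 else Z l j)
        + ∑ l, blockMatrix σ i l * (if σ l = σ j then 0 else Z l j)) :=
        Finset.sum_le_sum fun i _ => Finset.sum_le_sum fun j _ => blockMatrix_sub_apply σ hZ i j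
    _ = 2 * offMass σ Z := by
        rw [Finset.sum_comm]
        simp only [Finset.sum_add_distrib]
        rw [two_mul]
        congr 1
        · simp only [← Finset.sum_mul, hcol, one_mul, hT]
        · rw [← hT]
          refine Finset.sum_congr rfl fun j _ => ?_
          rw [Finset.sum_comm]
          simp only [← Finset.sum_mul, hcol, one_mul]

/-- The compression of `Z` to the orthogonal complement of the range of the block matrix. -/
def blockResidual (Z : Matrix (Fin n) (Fin n) ℝ) : Matrix (Fin n) (Fin n) ℝ :=
  (1 - blockMatrix σ) * Z * (1 - blockMatrix σ)

theorem trace_blockResidual (Z : Matrix (Fin n) (Fin n) ℝ) :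
    (blockResidual σ Z).trace = Z.trace - (Z * blockMatrix σ).trace := by
  have h : (1 - blockMatrix σ) * (1 - blockMatrix σ) = 1 - blockMatrix σ := by
    rw [Matrix.mul_sub, Matrix.mul_one, Matrix.sub_mul, Matrix.one_mul, blockMatrix_mul_self,
      sub_self, sub_zero]
  rw [blockResidual, Matrix.mul_assoc, trace_mul_comm, Matrix.mul_assoc, h, Matrix.mul_sub,
    Matrix.mul_one, trace_sub]

variable {σ}

/-- The trace equals `∑ i, P i i * (mass of row i outside its cluster)`, and `P i i ≤ 1 / minSize`.
-/
theorem trace_blockResidual_le (hσ : Function.Surjective σ) (hK : 1 ≤ K) (hZ : Z ∈ feasible n K) :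
    (minSize σ : ℝ) * (blockResidual σ Z).trace ≤ offMass σ Z := by
  have hN : (0 : ℝ) < minSize σ := Nat.cast_pos.mpr (minSize_pos hσ hK)
  have h1 : (blockResidual σ Z).trace
      = ∑ i, ∑ j, blockMatrix σ i i * (if σ i = σ j then 0 else Z i j) := by
    rw [trace_blockResidual, hZ.2.2.1, ← trace_blockMatrix hσ, trace, trace,
      ← Finset.sum_sub_distrib]
    refine Finset.sum_congr rfl fun i _ => ?_
    rw [diag, diag, mul_apply]
    have h1 : blockMatrix σ i i = ∑ j, blockMatrix σ i i * Z i j := by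
      rw [← Finset.mul_sum, sum_row_of_mem_feasible hZ, mul_one]
    conv_lhs => rw [h1]
    rw [← Finset.sum_sub_distrib]
    refine Finset.sum_congr rfl fun j _ => ?_
    simp only [blockMatrix_apply]
    by_cases h : σ i = σ j
    · simp [h, mul_comm]
    · simp [h, Ne.symm h]
  rw [h1, Finset.mul_sum]
  refine Finset.sum_le_sum fun i _ => ?_
  rw [Finset.mul_sum]
  refine Finset.sum_le_sum fun j _ => ?_
  split_ifs
  · simp
  · rw [← mul_assoc]
    have h2 : (minSize σ : ℝ) * blockMatrix σ i i ≤ 1 := by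
      rw [blockMatrix_apply, if_pos rfl]
      have h3 : (minSize σ : ℝ) ≤ (cluster σ (σ i)).card := Nat.cast_le.mpr (minSize_le σ _)
      rw [← div_eq_mul_inv]
      exact div_le_one_of_le₀ h3 (Nat.cast_nonneg _)
    exact mul_le_of_le_one_left (hZ.2.2.2.2 i j) h2

open scoped MatrixOrder in
theorem exists_eq_transpose_mul_self (hZ : Z.PosSemidef) :
    ∃ C : Matrix (Fin n) (Fin n) ℝ, Z = Cᵀ * C := by
  obtain ⟨C, hC⟩ := CStarAlgebra.nonneg_iff_eq_star_mul_self.mp hZ.nonneg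
  refine ⟨C, hC.trans ?_⟩
  rw [star_eq_conjTranspose, conjTranspose_eq_transpose_of_trivial]

theorem exists_blockResidual_eq (hZ : Z ∈ feasible n K) :
    ∃ C : Matrix (Fin n) (Fin n) ℝ, Z = Cᵀ * C ∧
      blockResidual σ Z = (C * (1 - blockMatrix σ))ᵀ * (C * (1 - blockMatrix σ)) := by
  obtain ⟨C, hC⟩ := exists_eq_transpose_mul_self hZ.2.1
  refine ⟨C, hC, ?_⟩
  rw [blockResidual, transpose_mul, transpose_sub, transpose_one, blockMatrix_transpose]
  conv_lhs => rw [hC]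
  simp only [Matrix.mul_assoc]

/-- The residual is `Bᵀ B`, so the trace is a sum of values of the quadratic form of `W` at the rows
of `B`. -/
theorem abs_trace_mul_blockResidual_le (hZ : Z ∈ feasible n K) (W : Matrix (Fin n) (Fin n) ℝ)
    {c : ℝ} (hW : ∀ v : Fin n → ℝ, |v ⬝ᵥ W *ᵥ v| ≤ c * (v ⬝ᵥ v)) :
    |(W * blockResidual σ Z).trace| ≤ c * (blockResidual σ Z).trace := by
  obtain ⟨C, -, hC⟩ := exists_blockResidual_eq (σ := σ) hZ
  rw [hC]
  set B := C * (1 - blockMatrix σ)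
  have h1 : (W * (Bᵀ * B)).trace = ∑ r, B r ⬝ᵥ W *ᵥ B r := by
    rw [← Matrix.mul_assoc, trace_mul_comm, ← Matrix.mul_assoc, trace]
    refine Finset.sum_congr rfl fun r _ => ?_
    rw [diag, Matrix.mul_assoc]
    rfl
  have h2 : (Bᵀ * B).trace = ∑ r, B r ⬝ᵥ B r := by
    rw [trace_mul_comm, trace]
    rfl
  rw [h1, h2, Finset.mul_sum]
  exact (Finset.abs_sum_le_sum_abs _ _).trans (Finset.sum_le_sum fun r _ => hW _)

/-- Without off-cluster mass the residual has trace zero, hence `Z = Z P`, and the `ℓ¹` bound gives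
`P = P Z`; transposing one of them yields `Z = P`. -/
theorem eq_blockMatrix_of_offMass_nonpos (hσ : Function.Surjective σ) (hK : 1 ≤ K)
    (hZ : Z ∈ feasible n K) (h0 : offMass σ Z ≤ 0) : Z = blockMatrix σ := by
  have hN : (0 : ℝ) < minSize σ := Nat.cast_pos.mpr (minSize_pos hσ hK)
  obtain ⟨C, hZC, hC⟩ := exists_blockResidual_eq (σ := σ) hZ
  have htr : (blockResidual σ Z).trace ≤ 0 := by
    have := trace_blockResidual_le hσ hK hZ
    by_contra! hlt
    have := mul_pos hN hlt
    linarith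
  have hB : C * (1 - blockMatrix σ) = 0 := by
    rw [← trace_conjTranspose_mul_self_eq_zero_iff, conjTranspose_eq_transpose_of_trivial, ← hC]
    refine le_antisymm htr ?_
    rw [hC, ← conjTranspose_eq_transpose_of_trivial]
    exact (posSemidef_conjTranspose_mul_self _).trace_nonneg
  have h1 : Z * (1 - blockMatrix σ) = 0 := by rw [hZC, Matrix.mul_assoc, hB, Matrix.mul_zero]
  have h2 : Z = Z * blockMatrix σ := by
    rw [Matrix.mul_sub, Matrix.mul_one, sub_eq_zero] at h1
    exact h1
  have h3 : ∀ i j, (blockMatrix σ * (blockMatrix σ - Z)) i j = 0 := by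
    intro i j
    have h := (sum_abs_blockMatrix_mul_sub_le σ hZ).trans (by linarith : 2 * offMass σ Z ≤ 0)
    have h' := (Finset.single_le_sum (f := fun j => |(blockMatrix σ * (blockMatrix σ - Z)) i j|)
      (fun j _ => abs_nonneg _) (Finset.mem_univ j)).trans
      (Finset.single_le_sum
        (f := fun i => ∑ j, |(blockMatrix σ * (blockMatrix σ - Z)) i j|)
        (fun i _ => Finset.sum_nonneg fun j _ => abs_nonneg _) (Finset.mem_univ i))
    exact abs_eq_zero.mp (le_antisymm (h'.trans h) (abs_nonneg _))
  have h4 : blockMatrix σ = blockMatrix σ * Z := by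
    have : blockMatrix σ * (blockMatrix σ - Z) = 0 := by ext i j; exact h3 i j
    rwa [Matrix.mul_sub, blockMatrix_mul_self, sub_eq_zero] at this
  have h5 : Zᵀ = Z := hZ.1
  calc Z = Zᵀ := h5.symm
    _ = (Z * blockMatrix σ)ᵀ := by rw [← h2]
    _ = blockMatrix σ * Z := by rw [transpose_mul, h5, blockMatrix_transpose]
    _ = blockMatrix σ := h4.symm

theorem abs_trace_mul_le (A B : Matrix (Fin n) (Fin n) ℝ) {c : ℝ} (hA : ∀ i j, |A i j| ≤ c) :
    |(A * B).trace| ≤ c * ∑ i, ∑ j, |B i j| := by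
  rw [trace_mul_comm, trace]
  simp only [diag, mul_apply, Finset.mul_sum]
  refine (Finset.abs_sum_le_sum_abs _ _).trans (Finset.sum_le_sum fun i _ => ?_)
  refine (Finset.abs_sum_le_sum_abs _ _).trans (Finset.sum_le_sum fun j _ => ?_)
  rw [abs_mul, mul_comm]
  exact mul_le_mul_of_nonneg_right (hA j i) (abs_nonneg _)

/-- The coefficient 6 is `(2 + 1) * 2`: three `ℓ^∞`-`ℓ¹` pairings with `P (P - Z)`, whose `ℓ¹` norm
is at most `2 * offMass`. The residual contributes `c`. -/
theorem abs_trace_mul_sub_le (hσ : Function.Surjective σ) (hK : 1 ≤ K) (hZ : Z ∈ feasible n K)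
    {W : Matrix (Fin n) (Fin n) ℝ} (hWs : Wᵀ = W) {b c : ℝ}
    (hb : ∀ i j, |(W * blockMatrix σ) i j| ≤ b) (hc : 0 ≤ c)
    (hW : ∀ v : Fin n → ℝ, |v ⬝ᵥ W *ᵥ v| ≤ c * minSize σ * (v ⬝ᵥ v)) :
    |(W * (blockMatrix σ - Z)).trace| ≤ (6 * b + c) * offMass σ Z := by
  have hb0 : 0 ≤ b := by
    obtain ⟨i, -⟩ := hσ ⟨0, hK⟩
    exact (abs_nonneg _).trans (hb i i)
  set P := blockMatrix σ with hP
  have hZs : Zᵀ = Z := hZ.1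
  have hPs : Pᵀ = P := blockMatrix_transpose σ
  have hPP : P * P = P := blockMatrix_mul_self σ
  have hl1 := sum_abs_blockMatrix_mul_sub_le σ hZ
  have e1 : (W * (P - Z)).trace = 2 * (W * P * (P * (P - Z))).trace
      - (P * (W * P) * (P * (P - Z))).trace - (W * blockResidual σ Z).trace := by
    have t1 : (W * (P * (P - Z))).trace = (W * ((P - Z) * P)).trace := by
      rw [← trace_transpose]
      simp only [transpose_mul, transpose_sub, hWs, hPs, hZs]
      rw [trace_mul_comm]
    have t2 : (W * P * (P * (P - Z))).trace = (W * (P * (P - Z))).trace := by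
      rw [← Matrix.mul_assoc (W * P), Matrix.mul_assoc W P P, hPP, Matrix.mul_assoc]
    have t3 : (P * (W * P) * (P * (P - Z))).trace = (W * (P * (P - Z) * P)).trace := by
      rw [Matrix.mul_assoc, trace_mul_comm, ← Matrix.mul_assoc (W * P), Matrix.mul_assoc W P P, hPP]
      simp only [Matrix.mul_assoc]
    rw [t2, t3, two_mul]
    -- Splitting along `P` and `1 - P`: as `(1 - P) P (1 - P) = 0`, the last corner of `P - Z` is
    -- minus the residual.
    conv_lhs => rw [show P - Z = P * (P - Z) + (P - Z) * P - P * (P - Z) * P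
      - blockResidual σ Z by
        rw [blockResidual]
        simp only [Matrix.mul_sub, Matrix.sub_mul, hPP, Matrix.mul_one, Matrix.one_mul, ← hP]
        abel]
    rw [Matrix.mul_sub, Matrix.mul_sub, Matrix.mul_add, trace_sub, trace_sub, trace_add, ← t1]
  have hb' : ∀ i j, |(P * (W * P)) i j| ≤ b := by
    intro i j
    rw [mul_apply]
    refine (Finset.abs_sum_le_sum_abs _ _).trans ?_
    calc ∑ l, |P i l * (W * P) l j| ≤ ∑ l, P i l * b := by
          refine Finset.sum_le_sum fun l _ => ?_
          rw [abs_mul, abs_of_nonneg (blockMatrix_nonneg σ i l)]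
          exact mul_le_mul_of_nonneg_left (hb l j) (blockMatrix_nonneg σ i l)
      _ = b := by rw [← Finset.sum_mul, sum_blockMatrix, one_mul]
  have i1 := abs_trace_mul_le (W * P) (P * (P - Z)) hb
  have i2 := abs_trace_mul_le (P * (W * P)) (P * (P - Z)) hb'
  have i3 := abs_trace_mul_blockResidual_le (σ := σ) hZ W hW
  have i4 := mul_le_mul_of_nonneg_left (trace_blockResidual_le hσ hK hZ) hc
  have i5 := mul_le_mul_of_nonneg_left hl1 hb0
  rw [abs_le] at *
  constructor <;> linarith

end BlockMatrix

/-! ### Deterministic recovery: signal against noise. -/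

section Recovery

open Matrix

variable {n K : ℕ} {σ : Fin n → Fin K} {H : Type*} [NormedAddCommGroup H] [InnerProductSpace ℝ H]

/-- The Gram matrix of `δ`, centred by `γ` on the diagonal. -/
def centredGram (δ : Fin n → H) (γ : ℝ) : Matrix (Fin n) (Fin n) ℝ :=
  Matrix.of fun i j => inner ℝ (δ i) (δ j) - if i = j then γ else 0

/-- The first bracket does not involve `Z`, so two feasible matrices are compared through the signal
sum and the centred noise alone. -/
theorem sum_gram_mul_eq {Z : Matrix (Fin n) (Fin n) ℝ} (hZ : Z ∈ feasible n K)
    (μ : Fin K → H) (δ : Fin n → H) (γ : ℝ) :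
    ∑ i, ∑ j, Matrix.gram ℝ (fun i => μ (σ i) + δ i) i j * Z i j
      = (∑ i, (‖μ (σ i)‖ ^ 2 + 2 * inner ℝ (δ i) (μ (σ i))) + γ * K)
        - (∑ i, ∑ j, Z i j * (‖μ (σ j) - μ (σ i)‖ ^ 2 / 2
          - 2 * inner ℝ (δ i) (μ (σ j) - μ (σ i))))
        + (centredGram δ γ * Z).trace := by
  have hrow := sum_row_of_mem_feasible hZ
  have hcol := sum_col_of_mem_feasible hZ
  have htr : ∑ i, ∑ j, (if i = j then γ else 0) * Z i j = γ * K := by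
    have : Z.trace = K := hZ.2.2.1
    rw [← this, trace, Finset.mul_sum]
    refine Finset.sum_congr rfl fun i _ => ?_
    simp
  have hW : (centredGram δ γ * Z).trace
      = ∑ i, ∑ j, (inner ℝ (δ i) (δ j) - if i = j then γ else 0) * Z i j := by
    rw [trace]
    refine Finset.sum_congr rfl fun i _ => ?_
    rw [diag, mul_apply]
    exact Finset.sum_congr rfl fun j _ => by rw [symm_of_mem_feasible hZ j i]; rfl
  have h1 : ∑ i, ∑ j, Z i j * (‖μ (σ i)‖ ^ 2 / 2 + 2 * inner ℝ (δ i) (μ (σ i)))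
      = ∑ i, (‖μ (σ i)‖ ^ 2 / 2 + 2 * inner ℝ (δ i) (μ (σ i))) := by
    refine Finset.sum_congr rfl fun i _ => ?_
    rw [← Finset.sum_mul, hrow, one_mul]
  have h2 : ∑ i, ∑ j, Z i j * (‖μ (σ j)‖ ^ 2 / 2) = ∑ j, ‖μ (σ j)‖ ^ 2 / 2 := by
    rw [Finset.sum_comm]
    refine Finset.sum_congr rfl fun j _ => ?_
    rw [← Finset.sum_mul, hcol, one_mul]
  have h3 : ∑ i, ∑ j, inner ℝ (μ (σ i)) (δ j) * Z i j
      = ∑ i, ∑ j, inner ℝ (δ i) (μ (σ j)) * Z i j := by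
    rw [Finset.sum_comm]
    refine Finset.sum_congr rfl fun j _ => Finset.sum_congr rfl fun i _ => ?_
    rw [symm_of_mem_feasible hZ i j, real_inner_comm]
  have h4 : ∑ i, (‖μ (σ i)‖ ^ 2 + 2 * inner ℝ (δ i) (μ (σ i)))
      = ∑ i, (‖μ (σ i)‖ ^ 2 / 2 + 2 * inner ℝ (δ i) (μ (σ i))) + ∑ j, ‖μ (σ j)‖ ^ 2 / 2 := by
    rw [← Finset.sum_add_distrib]
    exact Finset.sum_congr rfl fun i _ => by ring
  rw [h4, ← h1, ← h2, ← htr, hW, ← sub_eq_zero]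
  have h5 : ∑ i, ∑ j, inner ℝ (μ (σ i)) (δ j) * Z i j
      - ∑ i, ∑ j, inner ℝ (δ i) (μ (σ j)) * Z i j = 0 := sub_eq_zero.mpr h3
  rw [← h5]
  simp only [← Finset.sum_sub_distrib, ← Finset.sum_add_distrib]
  refine Finset.sum_congr rfl fun i _ => Finset.sum_congr rfl fun j _ => ?_
  rw [Matrix.gram_apply, inner_add_left, inner_add_right, inner_add_right, norm_sub_sq_real,
    inner_sub_right, real_inner_comm (μ (σ i)) (μ (σ j))]
  ring

theorem eq_blockMatrix_of_isSDPSolution (hσ : Function.Surjective σ) (hK : 1 ≤ K)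
    (μ : Fin K → H) (δ : Fin n → H) (γ Δ : ℝ) (hΔ : 0 < Δ)
    (hsep : ∀ k l, k ≠ l → Δ ≤ ‖μ k - μ l‖)
    (ha : ∀ i l, |inner ℝ (δ i) (μ l - μ (σ i))| ≤ ‖μ l - μ (σ i)‖ ^ 2 / 16)
    (hb : ∀ i j, |(centredGram δ γ * blockMatrix σ) i j| ≤ Δ ^ 2 / 32)
    (hc : ∀ v : Fin n → ℝ,
      |v ⬝ᵥ centredGram δ γ *ᵥ v| ≤ Δ ^ 2 / 32 * minSize σ * (v ⬝ᵥ v))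
    {Z : Matrix (Fin n) (Fin n) ℝ}
    (hZ : IsSDPSolution K (Matrix.gram ℝ fun i => μ (σ i) + δ i) Z) : Z = blockMatrix σ := by
  refine eq_blockMatrix_of_offMass_nonpos hσ hK hZ.1 ?_
  have hopt := hZ.2 _ (blockMatrix_mem_feasible hσ)
  rw [sum_gram_mul_eq hZ.1 μ δ γ, sum_gram_mul_eq (blockMatrix_mem_feasible hσ) μ δ γ] at hopt
  have hP : ∑ i, ∑ j, blockMatrix σ i j * (‖μ (σ j) - μ (σ i)‖ ^ 2 / 2
          - 2 * inner ℝ (δ i) (μ (σ j) - μ (σ i))) = 0 := by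
    refine Finset.sum_eq_zero fun i _ => Finset.sum_eq_zero fun j _ => ?_
    by_cases h : σ i = σ j
    · simp [h]
    · simp [blockMatrix_apply, h]
  have hS : 3 / 8 * Δ ^ 2 * offMass σ Z ≤ ∑ i, ∑ j, Z i j * (‖μ (σ j) - μ (σ i)‖ ^ 2 / 2
          - 2 * inner ℝ (δ i) (μ (σ j) - μ (σ i))) := by
    rw [offMass, Finset.mul_sum]
    refine Finset.sum_le_sum fun i _ => ?_
    rw [Finset.mul_sum]
    refine Finset.sum_le_sum fun j _ => ?_
    have h1 := (abs_le.mp (ha i (σ j))).2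
    have h2 := hZ.1.2.2.2.2 i j
    split_ifs with h
    · simp [h]
    · rw [mul_comm]
      refine mul_le_mul_of_nonneg_left ?_ h2
      have h3 : Δ ^ 2 ≤ ‖μ (σ j) - μ (σ i)‖ ^ 2 :=
        pow_le_pow_left₀ hΔ.le (hsep _ _ (Ne.symm h)) 2
      linarith
  have hWs : (centredGram δ γ)ᵀ = centredGram δ γ := by
    ext i j
    simp only [centredGram, transpose_apply, of_apply, real_inner_comm (δ i), eq_comm (a := i)]
  have hN := (abs_le.mp (abs_trace_mul_sub_le hσ hK hZ.1 hWs hb (by positivity) hc)).1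
  rw [Matrix.mul_sub, trace_sub] at hN
  have hΔ2 : 0 < Δ ^ 2 := by positivity
  -- Optimality leaves `12/32 Δ² offMass ≤ 7/32 Δ² offMass`, with `12/32 = 1/2 - 2/16` from the
  -- signal and `7/32 = (6 + 1)/32` from the noise.
  have hfin : Δ ^ 2 * offMass σ Z ≤ 0 := by
    have := offMass_nonneg σ hZ.1
    have := mul_nonneg hΔ2.le this
    linarith
  by_contra! hlt
  exact absurd hfin (not_le.mpr (mul_pos hΔ2 hlt))

end Recovery

/-! ### Hilbert-Schmidt norms and finite dimensional compressions. -/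

section HilbertSchmidt

variable {H : Type*} [NormedAddCommGroup H] [InnerProductSpace ℝ H] {ι : Type*}

theorem enorm_sq_eq_tsum (e : HilbertBasis ι ℝ H) (x : H) :
    ‖x‖ₑ ^ 2 = ∑' j, ENNReal.ofReal (inner ℝ (e j) x ^ 2) := by
  have h := e.hasSum_inner_mul_inner x x
  have h' : (fun j => inner ℝ x (e j) * inner ℝ (e j) x) = fun j => inner ℝ (e j) x ^ 2 := by
    ext j
    rw [real_inner_comm (e j) x, pow_two]
  rw [h', real_inner_self_eq_norm_sq] at h
  rw [← ENNReal.ofReal_tsum_of_nonneg (fun j => sq_nonneg _) h.summable, h.tsum_eq,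
    ENNReal.ofReal_pow (norm_nonneg _), ofReal_norm]

/-- Expand `T (b k)` in the basis `e`, exchange the sums using symmetry of `T`, and apply Bessel's
inequality to each `T (e j)`. -/
theorem sum_enorm_sq_apply_le_hsNormSq (e : HilbertBasis ι ℝ H) {T : H →L[ℝ] H}
    (hT : T.IsSymmetric) {κ : Type*} [Fintype κ] {b : κ → H} (hb : Orthonormal ℝ b) :
    ∑ k, ‖T (b k)‖ₑ ^ 2 ≤ hsNormSq e T := by
  simp only [enorm_sq_eq_tsum e (T _)]
  rw [← Summable.tsum_finsetSum (fun _ _ => ENNReal.summable), hsNormSq]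
  refine ENNReal.tsum_le_tsum fun j => ?_
  rw [← ENNReal.ofReal_sum_of_nonneg (fun _ _ => sq_nonneg _), ← ofReal_norm,
    ← ENNReal.ofReal_pow (norm_nonneg _)]
  refine ENNReal.ofReal_le_ofReal ?_
  have := hb.sum_inner_products_le (x := T (e j)) (s := Finset.univ)
  refine le_trans (le_of_eq (Finset.sum_congr rfl fun k _ => ?_)) this
  have h1 : inner ℝ (T (e j)) (b k) = inner ℝ (e j) (T (b k)) := hT (e j) (b k)
  rw [Real.norm_eq_abs, sq_abs, ← h1, real_inner_comm]

theorem sum_norm_sq_apply_le (e : HilbertBasis ι ℝ H) {T : H →L[ℝ] H}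
    (hT : T.IsSymmetric) {h : ℝ} (h0 : 0 ≤ h) (hh : hsNormSq e T ≤ ENNReal.ofReal h)
    {κ : Type*} [Fintype κ] {b : κ → H} (hb : Orthonormal ℝ b) :
    ∑ k, ‖T (b k)‖ ^ 2 ≤ h := by
  rw [← ENNReal.ofReal_le_ofReal_iff h0, ENNReal.ofReal_sum_of_nonneg (fun _ _ => sq_nonneg _)]
  refine le_trans (le_of_eq (Finset.sum_congr rfl fun k _ => ?_))
    ((sum_enorm_sq_apply_le_hsNormSq e hT hb).trans hh)
  rw [ENNReal.ofReal_pow (norm_nonneg _), ofReal_norm]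

theorem abs_le_norm_of_diagonal {T : H →L[ℝ] H} {d : ℕ} {b : Fin d → H} {s : Fin d → ℝ}
    (hb : Orthonormal ℝ b) (hbs : ∀ k l, inner ℝ (T (b k)) (b l) = if k = l then s k else 0)
    (k : Fin d) : |s k| ≤ ‖T (b k)‖ := by
  have h1 : s k = inner ℝ (T (b k)) (b k) := by rw [hbs, if_pos rfl]
  rw [h1]
  simpa [hb.norm_eq_one k] using abs_real_inner_le_norm (T (b k)) (b k)

/-- The compression of a symmetric operator to a finite dimensional subspace is diagonal in an
orthonormal basis. -/
theorem exists_orthonormal_diagonal {T : H →L[ℝ] H} (hT : T.IsSymmetric) (V : Submodule ℝ H)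
    [FiniteDimensional ℝ V] :
    ∃ (d : ℕ) (b : Fin d → H) (s : Fin d → ℝ), Orthonormal ℝ b ∧
      (∀ k l, inner ℝ (T (b k)) (b l) = if k = l then s k else 0) ∧
      ∀ x, inner ℝ (T (V.starProjection x)) (V.starProjection x)
        = ∑ k, s k * inner ℝ (b k) x ^ 2 := by
  let A : V →ₗ[ℝ] V := (V.orthogonalProjectionOnto : H →ₗ[ℝ] V) ∘ₗ (T : H →ₗ[ℝ] H) ∘ₗ V.subtype
  have hAin : ∀ x y : V, inner ℝ (A x) y = inner ℝ (T x) (y : H) := fun x y =>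
    Submodule.inner_orthogonalProjectionOnto_eq_of_mem_right y (T x)
  have hA : A.IsSymmetric := by
    intro x y
    rw [hAin, real_inner_comm (A y) x, hAin, real_inner_comm (x : H)]
    exact hT x y
  let b := hA.eigenvectorBasis rfl
  let s := hA.eigenvalues rfl
  have hAb : ∀ k, A (b k) = s k • b k := fun k => hA.apply_eigenvectorBasis rfl k
  refine ⟨_, fun k => (b k : H), s, ?_, fun k l => ?_, fun x => ?_⟩
  · exact b.orthonormal.comp_linearIsometry V.subtypeₗᵢ
  · rw [← hAin, hAb, real_inner_smul_left, orthonormal_iff_ite.mp b.orthonormal]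
    split_ifs <;> simp
  · have h1 : inner ℝ (T (V.starProjection x)) (V.starProjection x)
        = inner ℝ (A (V.orthogonalProjectionOnto x)) (V.orthogonalProjectionOnto x) := by
      rw [hAin]
      rfl
    rw [h1, ← b.sum_inner_mul_inner]
    refine Finset.sum_congr rfl fun k _ => ?_
    rw [hA, hAb, real_inner_smul_right, real_inner_comm, mul_assoc, ← pow_two]
    congr 2
    exact Submodule.inner_orthogonalProjectionOnto_eq_of_mem_left (b k) x

/-- These subspaces carry the passage from finite to infinite dimension in
`lintegral_exp_quadratic_le`. -/
theorem exists_monotone_finiteDimensional_dense (H : Type*) [NormedAddCommGroup H]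
    [InnerProductSpace ℝ H] [TopologicalSpace.SeparableSpace H] :
    ∃ V : ℕ → Submodule ℝ H, Monotone V ∧ (∀ N, FiniteDimensional ℝ (V N)) ∧
      ⊤ ≤ (⨆ N, V N).topologicalClosure := by
  refine ⟨fun N => Submodule.span ℝ (TopologicalSpace.denseSeq H '' Set.Iio N), ?_, ?_, ?_⟩
  · intro M N h
    exact Submodule.span_mono (Set.image_mono (Set.Iio_subset_Iio h))
  · intro N
    exact FiniteDimensional.span_of_finite ℝ ((Set.finite_Iio N).image _)
  · intro x _
    have hsub : Set.range (TopologicalSpace.denseSeq H) ⊆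
        ((⨆ N, Submodule.span ℝ (TopologicalSpace.denseSeq H '' Set.Iio N) : Submodule ℝ H) :
          Set H) := by
      rintro _ ⟨m, rfl⟩
      exact Submodule.mem_iSup_of_mem (m + 1)
        (Submodule.subset_span ⟨m, Set.mem_Iio.mpr (Nat.lt_succ_self m), rfl⟩)
    exact closure_mono hsub (TopologicalSpace.denseRange_denseSeq H x)

end HilbertSchmidt

/-! ### Exponential moments of a standard gaussian variable. -/

section Gaussian

theorem lintegral_exp_mul_gaussian (t : ℝ) :
    ∫⁻ g, ENNReal.ofReal (Real.exp (t * g)) ∂(gaussianReal 0 1)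
      = ENNReal.ofReal (Real.exp (t ^ 2 / 2)) := by
  rw [← ofReal_integral_eq_lintegral_ofReal (integrable_exp_mul_gaussianReal t)
    (Filter.Eventually.of_forall fun _ => (Real.exp_pos _).le)]
  have := congr_fun (mgf_id_gaussianReal (μ := 0) (v := 1)) t
  simp only [mgf, id_eq] at this
  rw [this]
  simp

/-- The integral is `(1 - 2b)^(-1/2)`. For `0 ≤ b ≤ 1/4` one has `1 ≤ (1 + 4b)(1 - 2b) ≤ exp (4b) (1
- 2b)`. -/
theorem lintegral_exp_mul_sq_gaussian_le {b : ℝ} (h0 : 0 ≤ b) (hb : b ≤ 1 / 4) :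
    ∫⁻ g, ENNReal.ofReal (Real.exp (b * g ^ 2)) ∂(gaussianReal 0 1)
      ≤ ENNReal.ofReal (Real.exp (2 * b)) := by
  have hc : 0 < 1 / 2 - b := by linarith
  rw [gaussianReal_of_var_ne_zero 0 one_ne_zero,
    lintegral_withDensity_eq_lintegral_mul _ (measurable_gaussianPDF 0 1)
      (by fun_prop : Measurable fun g : ℝ => ENNReal.ofReal (Real.exp (b * g ^ 2)))]
  have h1 : ∀ x : ℝ, (gaussianPDF 0 1 * fun g : ℝ => ENNReal.ofReal (Real.exp (b * g ^ 2))) x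
      = ENNReal.ofReal ((√(2 * Real.pi))⁻¹ * Real.exp (-(1 / 2 - b) * x ^ 2)) := by
    intro x
    rw [Pi.mul_apply, gaussianPDF, ← ENNReal.ofReal_mul (gaussianPDFReal_nonneg _ _ _),
      gaussianPDFReal, mul_assoc, ← Real.exp_add]
    congr 3
    · simp
    · simp; ring
  simp only [h1]
  rw [← ofReal_integral_eq_lintegral_ofReal ((integrable_exp_neg_mul_sq hc).const_mul _)
    (Filter.Eventually.of_forall fun _ => by positivity), integral_const_mul, integral_gaussian]
  refine ENNReal.ofReal_le_ofReal ?_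
  rw [← Real.sqrt_inv, ← Real.sqrt_mul (by positivity)]
  refine Real.sqrt_le_iff.mpr ⟨(Real.exp_pos _).le, ?_⟩
  rw [← Real.exp_nat_mul]
  have h2 : (2 * Real.pi)⁻¹ * (Real.pi / (1 / 2 - b)) = 1 / (1 - 2 * b) := by
    have := Real.pi_pos.ne'
    have h3 : (1 - 2 * b) ≠ 0 := by linarith
    have h4 : (1 / 2 - b) ≠ 0 := hc.ne'
    have h5 : 1 - 2 * b = 2 * (1 / 2 - b) := by ring
    rw [h5]
    field_simp
  rw [h2, div_le_iff₀ (by linarith)]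
  have h3 : 1 + 4 * b ≤ Real.exp ((2 : ℕ) * (2 * b)) := by
    have := Real.add_one_le_exp ((2 : ℕ) * (2 * b))
    push_cast at this ⊢
    linarith
  calc (1 : ℝ) ≤ (1 + 4 * b) * (1 - 2 * b) := by nlinarith
    _ ≤ _ := mul_le_mul_of_nonneg_right h3 (by linarith)

end Gaussian

/-! ### Exponential moments of quadratic forms of sub-gaussian vectors. -/

section QuadraticForm

variable {H : Type*} [NormedAddCommGroup H] [InnerProductSpace ℝ H]
  {Ω : Type*} [MeasurableSpace Ω] [MeasurableSpace H] [BorelSpace H]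

/-- The exponential moment of a diagonal quadratic form of a sub-gaussian vector, by writing
`exp (t² / 2)` as the moment generating function of a standard gaussian variable. -/
theorem lintegral_exp_sum_sq_le {P : Measure Ω} [SFinite P] {U : Ω → H} (hU : Measurable U)
    {T : H →L[ℝ] H} {a β : ℝ} (ha : 0 ≤ a) (hβ : 0 ≤ β)
    (hsub : ∀ z : H, ∫⁻ ω, ENNReal.ofReal (Real.exp (inner ℝ z (U ω))) ∂P
      ≤ ENNReal.ofReal (Real.exp (β * inner ℝ (T z) z / 2)))
    {κ : Type*} [Fintype κ] [DecidableEq κ] (b : κ → H) (s : κ → ℝ) (hs : ∀ k, 0 ≤ s k)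
    (hb : ∀ k l, inner ℝ (T (b k)) (b l) = if k = l then s k else 0)
    (hsmall : ∀ k, a * β * s k ^ 2 ≤ 1 / 4) :
    ∫⁻ ω, ENNReal.ofReal (Real.exp (a * ∑ k, s k * inner ℝ (b k) (U ω) ^ 2)) ∂P
      ≤ ENNReal.ofReal (Real.exp (2 * (a * β) * ∑ k, s k ^ 2)) := by
  set G : Measure (κ → ℝ) := Measure.pi fun _ => gaussianReal 0 1 with hG
  have hprod : ∀ f : κ → ℝ → ℝ, (∀ k, Measurable (f k)) →
      ∫⁻ g, ENNReal.ofReal (Real.exp (∑ k, f k (g k))) ∂G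
        = ∏ k, ∫⁻ x, ENNReal.ofReal (Real.exp (f k x)) ∂(gaussianReal 0 1) := by
    intro f hf
    have hmeas : ∀ k, Measurable fun x => ENNReal.ofReal (Real.exp (f k x)) := fun k =>
      (Real.measurable_exp.comp (hf k)).ennreal_ofReal
    have hind : iIndepFun (fun k (g : κ → ℝ) => ENNReal.ofReal (Real.exp (f k (g k)))) G :=
      iIndepFun_pi (X := fun k x => ENNReal.ofReal (Real.exp (f k x)))
        fun k => (hmeas k).aemeasurable
    simp only [Real.exp_sum, ENNReal.ofReal_prod_of_nonneg fun _ _ => (Real.exp_pos _).le]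
    rw [lintegral_prod_eq_prod_lintegral_of_indepFun Finset.univ _ hind
      (fun k => (hmeas k).comp (measurable_pi_apply k))]
    refine Finset.prod_congr rfl fun k _ => ?_
    exact (measurePreserving_eval (fun _ => gaussianReal 0 1) k).lintegral_comp (hmeas k)
  -- Linearization: each squared coordinate becomes the average of an exponential that is linear in
  -- `U`, to which `hsub` applies after the swap of integrals.
  have hlin : ∀ ω, ENNReal.ofReal (Real.exp (a * ∑ k, s k * inner ℝ (b k) (U ω) ^ 2))
      = ∫⁻ g, ENNReal.ofReal (Real.exp (∑ k, (√(2 * a * s k) * inner ℝ (b k) (U ω)) * g k)) ∂G := by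
    intro ω
    rw [hprod (fun k x => (√(2 * a * s k) * inner ℝ (b k) (U ω)) * x) (fun k => by fun_prop)]
    simp only [lintegral_exp_mul_gaussian]
    rw [← ENNReal.ofReal_prod_of_nonneg fun _ _ => (Real.exp_pos _).le, ← Real.exp_sum,
      Finset.mul_sum]
    congr 2
    refine Finset.sum_congr rfl fun k _ => ?_
    rw [mul_pow, Real.sq_sqrt (by have := hs k; positivity)]
    ring
  have hinner : ∀ k, Measurable fun ω => inner ℝ (b k) (U ω) := fun k =>
    (continuous_const.inner continuous_id).measurable.comp hU
  simp only [hlin]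
  rw [lintegral_lintegral_swap]
  swap
  · refine Measurable.aemeasurable ?_
    refine (Real.measurable_exp.comp ?_).ennreal_ofReal
    refine Finset.measurable_sum _ fun k _ => ?_
    exact (((hinner k).comp measurable_fst).const_mul _).mul
      ((measurable_pi_apply k).comp measurable_snd)
  calc ∫⁻ g, ∫⁻ ω, ENNReal.ofReal
          (Real.exp (∑ k, (√(2 * a * s k) * inner ℝ (b k) (U ω)) * g k)) ∂P ∂G
      ≤ ∫⁻ g, ENNReal.ofReal (Real.exp (∑ k, (a * β * s k ^ 2) * g k ^ 2)) ∂G := by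
        refine lintegral_mono fun g => ?_
        have := hsub (∑ k, (√(2 * a * s k) * g k) • b k)
        refine le_trans (le_of_eq ?_) (this.trans (le_of_eq ?_))
        · refine lintegral_congr fun ω => ?_
          rw [sum_inner]
          congr 2
          refine Finset.sum_congr rfl fun k _ => ?_
          rw [real_inner_smul_left]
          ring
        · congr 2
          simp only [map_sum, map_smul, sum_inner, inner_sum, real_inner_smul_left,
            real_inner_smul_right, hb]
          rw [mul_div_assoc, Finset.sum_div, Finset.mul_sum]
          refine Finset.sum_congr rfl fun k _ => ?_
          simp only [mul_ite, mul_zero, Finset.sum_ite_eq', Finset.mem_univ, if_true]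
          have h2 := Real.sq_sqrt (show 0 ≤ 2 * a * s k by have := hs k; positivity)
          calc _ = β * s k / 2 * g k ^ 2 * √(2 * a * s k) ^ 2 := by ring
            _ = _ := by rw [h2]; ring
    _ = ∏ k, ∫⁻ x, ENNReal.ofReal (Real.exp ((a * β * s k ^ 2) * x ^ 2)) ∂(gaussianReal 0 1) :=
        hprod (fun k x => (a * β * s k ^ 2) * x ^ 2) (fun k => by fun_prop)
    _ ≤ ∏ k, ENNReal.ofReal (Real.exp (2 * (a * β * s k ^ 2))) :=
        Finset.prod_le_prod' fun k _ =>
          lintegral_exp_mul_sq_gaussian_le (by positivity) (hsmall k)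
    _ = _ := by
        rw [← ENNReal.ofReal_prod_of_nonneg fun _ _ => (Real.exp_pos _).le, ← Real.exp_sum,
          Finset.mul_sum]
        congr 2
        exact Finset.sum_congr rfl fun k _ => by ring

/-- The exponential moment of the quadratic form of a positive Hilbert-Schmidt operator `T` at a
vector that is sub-gaussian with respect to `β T`. -/
theorem lintegral_exp_quadratic_le [TopologicalSpace.SeparableSpace H]
    {ι : Type*} (e : HilbertBasis ι ℝ H)
    {P : Measure Ω} [SFinite P] {U : Ω → H} (hU : Measurable U)
    {T : H →L[ℝ] H} (hT : T.IsPositive) {h : ℝ} (h0 : 0 ≤ h)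
    (hh : hsNormSq e T ≤ ENNReal.ofReal h) {a β : ℝ} (ha : 0 ≤ a) (hβ : 0 ≤ β)
    (hsub : ∀ z : H, ∫⁻ ω, ENNReal.ofReal (Real.exp (inner ℝ z (U ω))) ∂P
      ≤ ENNReal.ofReal (Real.exp (β * inner ℝ (T z) z / 2)))
    (hsmall : a * β * ‖T‖ ^ 2 ≤ 1 / 4) :
    ∫⁻ ω, ENNReal.ofReal (Real.exp (a * inner ℝ (T (U ω)) (U ω))) ∂P
      ≤ ENNReal.ofReal (Real.exp (2 * (a * β) * h)) := by
  obtain ⟨V, hVm, hVf, hVd⟩ := exists_monotone_finiteDimensional_dense H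
  set q : H → ℝ≥0∞ := fun x => ENNReal.ofReal (Real.exp (a * inner ℝ (T x) x)) with hq
  have hqc : Continuous q :=
    ENNReal.continuous_ofReal.comp (Real.continuous_exp.comp
      (continuous_const.mul (T.continuous.inner continuous_id)))
  have hN : ∀ N, ∫⁻ ω, q ((V N).starProjection (U ω)) ∂P
      ≤ ENNReal.ofReal (Real.exp (2 * (a * β) * h)) := by
    intro N
    obtain ⟨d, b, s, hb, hbs, hx⟩ := exists_orthonormal_diagonal hT.1 (V N)
    have hs : ∀ k, 0 ≤ s k := fun k => by
      have : s k = inner ℝ (T (b k)) (b k) := by rw [hbs, if_pos rfl]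
      rw [this]
      exact hT.inner_nonneg_left _
    have hs2 : ∀ k, s k ^ 2 ≤ ‖T (b k)‖ ^ 2 := fun k =>
      sq_le_sq' (by have := abs_le.mp (abs_le_norm_of_diagonal hb hbs k); linarith)
        (le_of_abs_le (abs_le_norm_of_diagonal hb hbs k))
    simp only [hq, hx]
    refine (lintegral_exp_sum_sq_le hU ha hβ hsub b s hs hbs fun k => ?_).trans ?_
    · refine le_trans (mul_le_mul_of_nonneg_left ((hs2 k).trans ?_) (by positivity)) hsmall
      refine pow_le_pow_left₀ (norm_nonneg _) ?_ 2
      simpa [hb.norm_eq_one k] using T.le_opNorm (b k)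
    · refine ENNReal.ofReal_le_ofReal (Real.exp_le_exp.mpr ?_)
      refine mul_le_mul_of_nonneg_left ?_ (by positivity)
      exact (Finset.sum_le_sum fun k _ => hs2 k).trans (sum_norm_sq_apply_le e hT.1 h0 hh hb)
  -- The bounds on the compressions are uniform in `N`, so Fatou's lemma passes them to the limit.
  calc ∫⁻ ω, q (U ω) ∂P
      = ∫⁻ ω, Filter.liminf (fun N => q ((V N).starProjection (U ω))) Filter.atTop ∂P := by
        refine lintegral_congr fun ω => ?_
        exact (((hqc.tendsto _).comp
          (Submodule.starProjection_tendsto_self V hVm (U ω) hVd)).liminf_eq).symm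
    _ ≤ Filter.liminf (fun N => ∫⁻ ω, q ((V N).starProjection (U ω)) ∂P) Filter.atTop :=
        lintegral_liminf_le fun N =>
          (hqc.comp (V N).starProjection.continuous).measurable.comp hU
    _ ≤ _ := Filter.liminf_le_of_frequently_le' (Filter.Frequently.of_forall hN)

end QuadraticForm

/-! ### Chernoff bounds. -/

section Tail

variable {Ω : Type*} [MeasurableSpace Ω] {P : Measure Ω}

theorem measure_ge_le_of_lintegral_exp_le {f : Ω → ℝ} (hf : Measurable f) {t r B : ℝ}
    (ht : 0 ≤ t)
    (h : ∫⁻ ω, ENNReal.ofReal (Real.exp (t * f ω)) ∂P ≤ ENNReal.ofReal (Real.exp B)) :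
    P {ω | r ≤ f ω} ≤ ENNReal.ofReal (Real.exp (B - t * r)) := by
  have h1 := mul_meas_ge_le_lintegral (μ := P)
    (f := fun ω => ENNReal.ofReal (Real.exp (t * f ω))) (by fun_prop)
    (ENNReal.ofReal (Real.exp (t * r)))
  have h2 : P {ω | r ≤ f ω} ≤ P {ω | ENNReal.ofReal (Real.exp (t * r))
      ≤ ENNReal.ofReal (Real.exp (t * f ω))} :=
    measure_mono fun ω hω => ENNReal.ofReal_le_ofReal
      (Real.exp_le_exp.mpr (mul_le_mul_of_nonneg_left hω ht))
  have h3 : ENNReal.ofReal (Real.exp (t * r)) * P {ω | r ≤ f ω} ≤ ENNReal.ofReal (Real.exp B) :=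
    (mul_le_mul_right h2 _).trans (h1.trans h)
  rw [Real.exp_sub, ENNReal.ofReal_div_of_pos (Real.exp_pos _),
    ENNReal.le_div_iff_mul_le (Or.inl (by simp [Real.exp_pos])) (Or.inl ENNReal.ofReal_ne_top),
    mul_comm]
  exact h3

theorem measure_abs_ge_le_of_lintegral_exp_le {f : Ω → ℝ} (hf : Measurable f) {t r B : ℝ}
    (ht : 0 ≤ t)
    (h : ∀ c : ℝ, |c| = t →
      ∫⁻ ω, ENNReal.ofReal (Real.exp (c * f ω)) ∂P ≤ ENNReal.ofReal (Real.exp B)) :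
    P {ω | r ≤ |f ω|} ≤ ENNReal.ofReal (2 * Real.exp (B - t * r)) := by
  have h1 := measure_ge_le_of_lintegral_exp_le (r := r) hf ht (h t (abs_of_nonneg ht))
  have h2 := measure_ge_le_of_lintegral_exp_le (f := fun ω => -f ω) (r := r) (P := P) (B := B)
    hf.neg ht (by simpa using h (-t) (by rw [abs_neg, abs_of_nonneg ht]))
  have h3 : {ω | r ≤ |f ω|} ⊆ {ω | r ≤ f ω} ∪ {ω | r ≤ -f ω} := by
    intro ω hω
    exact (le_abs.mp (show r ≤ |f ω| from hω) : r ≤ f ω ∨ r ≤ -f ω)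
  refine (measure_mono h3).trans ((measure_union_le _ _).trans ((add_le_add h1 h2).trans ?_))
  rw [← ENNReal.ofReal_add (Real.exp_pos _).le (Real.exp_pos _).le, two_mul]

end Tail

/-! ### Off-diagonal sums as averages over bipartitions. -/

section Decoupling

variable {n : ℕ}

/-- These sets form the interval from `{i}` to the complement of `{j}`: a uniformly random subset
separates an ordered pair with probability `1/4`. -/
theorem card_filter_mem_notMem {i j : Fin n} (hij : i ≠ j) :
    4 * (Finset.univ.filter fun I : Finset (Fin n) => i ∈ I ∧ j ∉ I).card = 2 ^ n := by
  have h1 : (Finset.univ.filter fun I : Finset (Fin n) => i ∈ I ∧ j ∉ I)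
      = Finset.Icc {i} (Finset.univ.erase j) := by
    ext I
    simp only [Finset.mem_filter, Finset.mem_univ, true_and, Finset.mem_Icc,
      Finset.singleton_subset_iff, and_congr_right_iff]
    intro _
    exact ⟨fun hj k hk => Finset.mem_erase.mpr ⟨fun h => hj (h ▸ hk), Finset.mem_univ k⟩,
      fun h hj => (Finset.mem_erase.mp (h hj)).1 rfl⟩
  rw [h1, Finset.card_Icc_finset (by simpa using hij)]
  have h2 : 2 ≤ n := by
    have hi := i.2
    have hj := j.2
    have : (i : ℕ) ≠ j := fun h => hij (Fin.ext h)
    omega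
  simp only [Finset.card_erase_of_mem (Finset.mem_univ j), Finset.card_univ, Fintype.card_fin,
    Finset.card_singleton]
  obtain ⟨m, rfl⟩ := Nat.exists_eq_add_of_le h2
  rw [show 2 + m - 1 - 1 = m by omega, pow_add]
  norm_num

theorem sum_offDiag_eq_average (a : Fin n → Fin n → ℝ) :
    ∑ i, ∑ j, (if i = j then 0 else a i j)
      = ∑ I : Finset (Fin n), (2 ^ n : ℝ)⁻¹ * (4 * ∑ i ∈ I, ∑ j ∈ Iᶜ, a i j) := by
  have h1 : ∀ I : Finset (Fin n), ∑ i ∈ I, ∑ j ∈ Iᶜ, a i j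
      = ∑ i, ∑ j, if i ∈ I ∧ j ∉ I then a i j else 0 := by
    intro I
    rw [← Finset.sum_filter_add_sum_filter_not Finset.univ (· ∈ I)
      (fun i => ∑ j, if i ∈ I ∧ j ∉ I then a i j else 0)]
    have h2 : ∑ i with i ∉ I, ∑ j, (if i ∈ I ∧ j ∉ I then a i j else 0) = 0 :=
      Finset.sum_eq_zero fun i hi => Finset.sum_eq_zero fun j _ => by
        rw [if_neg]
        exact fun h => (Finset.mem_filter.mp hi).2 h.1
    rw [h2, add_zero, Finset.filter_univ_mem]
    refine Finset.sum_congr rfl fun i hi => ?_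
    rw [← Finset.sum_filter]
    refine Finset.sum_congr ?_ fun _ _ => rfl
    ext j
    simp [hi]
  have h2 : ∑ I : Finset (Fin n), (2 ^ n : ℝ)⁻¹ * (4 * ∑ i ∈ I, ∑ j ∈ Iᶜ, a i j)
      = ∑ i, ∑ j, (2 ^ n : ℝ)⁻¹ *
        (4 * ∑ I : Finset (Fin n), if i ∈ I ∧ j ∉ I then a i j else 0) := by
    simp only [h1, Finset.mul_sum]
    rw [Finset.sum_comm]
    exact Finset.sum_congr rfl fun i _ => Finset.sum_comm
  rw [h2]
  refine Finset.sum_congr rfl fun i _ => Finset.sum_congr rfl fun j _ => ?_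
  rw [← Finset.sum_filter, Finset.sum_const, nsmul_eq_mul]
  split_ifs with hij
  · subst hij
    simp
  · have h3 : (4 : ℝ) * ((Finset.univ.filter fun I : Finset (Fin n) => i ∈ I ∧ j ∉ I).card : ℝ)
        = 2 ^ n := by exact_mod_cast card_filter_mem_notMem hij
    rw [← mul_assoc 4, h3, ← mul_assoc, inv_mul_cancel₀ (by positivity), one_mul]

end Decoupling

/-! ### Tails of the off-diagonal bilinear form. -/

section Chaos

variable {H : Type*} [NormedAddCommGroup H] [InnerProductSpace ℝ H] {n : ℕ}

/-- The off-diagonal bilinear form of the Gram matrix of `δ`. -/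
def chaos (δ : Fin n → H) (x y : Fin n → ℝ) : ℝ :=
  ∑ i, ∑ j, if i = j then 0 else x i * y j * inner ℝ (δ i) (δ j)

theorem chaos_smul_left (δ : Fin n → H) (c : ℝ) (x y : Fin n → ℝ) :
    chaos δ (fun i => c * x i) y = c * chaos δ x y := by
  simp only [chaos, Finset.mul_sum]
  refine Finset.sum_congr rfl fun i _ => Finset.sum_congr rfl fun j _ => ?_
  split_ifs
  · simp
  · ring

/-- Jensen's inequality for the average over bipartitions; the factor 4 is the inverse of the
separation probability. -/
theorem exp_chaos_le (δ : Fin n → H) (x y : Fin n → ℝ) :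
    Real.exp (chaos δ x y) ≤ ∑ I : Finset (Fin n), (2 ^ n : ℝ)⁻¹ *
      Real.exp (4 * inner ℝ (∑ i ∈ I, x i • δ i) (∑ j ∈ Iᶜ, y j • δ j)) := by
  rw [chaos, sum_offDiag_eq_average]
  have h := convexOn_exp.map_sum_le (t := (Finset.univ : Finset (Finset (Fin n))))
    (w := fun _ => (2 ^ n : ℝ)⁻¹)
    (p := fun I => 4 * ∑ i ∈ I, ∑ j ∈ Iᶜ, x i * y j * inner ℝ (δ i) (δ j))
    (fun _ _ => by positivity) (by simp) (fun _ _ => Set.mem_univ _)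
  simp only [smul_eq_mul] at h
  refine h.trans (le_of_eq (Finset.sum_congr rfl fun I _ => ?_))
  simp only [sum_inner, inner_sum, real_inner_smul_left, real_inner_smul_right]
  rw [Finset.sum_comm]
  congr 3
  exact Finset.sum_congr rfl fun i _ => Finset.sum_congr rfl fun j _ => by ring

variable [MeasurableSpace H] [BorelSpace H] [SecondCountableTopology H]
  {Ω : Type*} [MeasurableSpace Ω] {P : Measure Ω} {δ : Fin n → Ω → H}

theorem measurable_chaos (hδ : ∀ i, Measurable (δ i)) (x y : Fin n → ℝ) :
    Measurable fun ω => chaos (fun i => δ i ω) x y := by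
  refine Finset.measurable_sum _ fun i _ => Finset.measurable_sum _ fun j _ => ?_
  split_ifs
  · exact measurable_const
  · exact ((hδ i).inner (hδ j)).const_mul _

variable {T : H →L[ℝ] H} {β : ℝ}

theorem lintegral_exp_inner_sum_le (hδ : ∀ i, Measurable (δ i)) (hind : iIndepFun δ P)
    (hsub : ∀ i z, ∫⁻ ω, ENNReal.ofReal (Real.exp (inner ℝ z (δ i ω))) ∂P
      ≤ ENNReal.ofReal (Real.exp (β * inner ℝ (T z) z / 2)))
    (x : Fin n → ℝ) (I : Finset (Fin n)) (z : H) :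
    ∫⁻ ω, ENNReal.ofReal (Real.exp (inner ℝ z (∑ i ∈ I, x i • δ i ω))) ∂P
      ≤ ENNReal.ofReal (Real.exp ((β * ∑ i ∈ I, x i ^ 2) * inner ℝ (T z) z / 2)) := by
  have hm : ∀ i, Measurable fun v : H => ENNReal.ofReal (Real.exp (inner ℝ z (x i • v))) :=
    fun i => by fun_prop
  have hind' := hind.comp _ hm
  simp only [inner_sum, Real.exp_sum, ENNReal.ofReal_prod_of_nonneg fun _ _ => (Real.exp_pos _).le]
  have h1 := lintegral_prod_eq_prod_lintegral_of_indepFun I _ hind' (fun i => (hm i).comp (hδ i))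
  simp only [Function.comp_apply] at h1
  rw [h1]
  calc ∏ i ∈ I, ∫⁻ ω, ENNReal.ofReal (Real.exp (inner ℝ z (x i • δ i ω))) ∂P
      ≤ ∏ i ∈ I, ENNReal.ofReal (Real.exp (β * x i ^ 2 * inner ℝ (T z) z / 2)) := by
        refine Finset.prod_le_prod' fun i _ => ?_
        have h2 := hsub i (x i • z)
        simp only [map_smul, real_inner_smul_left, real_inner_smul_right] at h2
        simp only [real_inner_smul_right]
        exact h2.trans (le_of_eq (by congr 2; ring))
    _ = _ := by
        rw [← ENNReal.ofReal_prod_of_nonneg fun _ _ => (Real.exp_pos _).le, ← Real.exp_sum]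
        congr 2
        rw [Finset.mul_sum, Finset.sum_mul, Finset.sum_div]

variable [IsProbabilityMeasure P] {ι : Type*} (e : HilbertBasis ι ℝ H)

/-- Integrating over `U` with `V` frozen gives `exp (c² β₁ ⟨T V, V⟩ / 2)`, whose expectation is
controlled by the quadratic form bound. -/
theorem lintegral_exp_inner_of_indepFun_le {U V : Ω → H} (hU : Measurable U) (hV : Measurable V)
    (hUV : IndepFun U V P) (hT : T.IsPositive) {h : ℝ} (h0 : 0 ≤ h)
    (hh : hsNormSq e T ≤ ENNReal.ofReal h) {β₁ β₂ : ℝ} (hβ₁ : 0 ≤ β₁) (hβ₂ : 0 ≤ β₂)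
    (hsubU : ∀ z, ∫⁻ ω, ENNReal.ofReal (Real.exp (inner ℝ z (U ω))) ∂P
      ≤ ENNReal.ofReal (Real.exp (β₁ * inner ℝ (T z) z / 2)))
    (hsubV : ∀ z, ∫⁻ ω, ENNReal.ofReal (Real.exp (inner ℝ z (V ω))) ∂P
      ≤ ENNReal.ofReal (Real.exp (β₂ * inner ℝ (T z) z / 2)))
    (c : ℝ) (hsmall : c ^ 2 * β₁ * β₂ * ‖T‖ ^ 2 ≤ 1 / 2) :
    ∫⁻ ω, ENNReal.ofReal (Real.exp (c * inner ℝ (U ω) (V ω))) ∂P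
      ≤ ENNReal.ofReal (Real.exp (c ^ 2 * β₁ * β₂ * h)) := by
  have hf : Measurable fun p : H × H => ENNReal.ofReal (Real.exp (c * inner ℝ p.2 p.1)) := by
    fun_prop
  have h1 : ∫⁻ ω, ENNReal.ofReal (Real.exp (c * inner ℝ (U ω) (V ω))) ∂P
      = ∫⁻ ω, ∫⁻ ω', ENNReal.ofReal (Real.exp (inner ℝ (c • V ω) (U ω'))) ∂P ∂P := by
    have h2 := (indepFun_iff_map_prod_eq_prod_map_map hV.aemeasurable hU.aemeasurable).mp hUV.symm
    have : IsProbabilityMeasure (P.map U) := Measure.isProbabilityMeasure_map hU.aemeasurable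
    calc _ = ∫⁻ p, ENNReal.ofReal (Real.exp (c * inner ℝ p.2 p.1)) ∂(P.map fun ω => (V ω, U ω)) := by
          rw [lintegral_map hf (hV.prodMk hU)]
      _ = ∫⁻ v, ∫⁻ u, ENNReal.ofReal (Real.exp (c * inner ℝ u v)) ∂(P.map U) ∂(P.map V) := by
          rw [h2, lintegral_prod _ hf.aemeasurable]
      _ = ∫⁻ ω, ∫⁻ u, ENNReal.ofReal (Real.exp (c * inner ℝ u (V ω))) ∂(P.map U) ∂P := by
          rw [lintegral_map _ hV]
          exact hf.lintegral_prod_right'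
      _ = _ := by
          refine lintegral_congr fun ω => ?_
          rw [lintegral_map (by fun_prop) hU]
          refine lintegral_congr fun ω' => ?_
          rw [real_inner_smul_left, real_inner_comm]
  rw [h1]
  calc ∫⁻ ω, ∫⁻ ω', ENNReal.ofReal (Real.exp (inner ℝ (c • V ω) (U ω'))) ∂P ∂P
      ≤ ∫⁻ ω, ENNReal.ofReal (Real.exp ((c ^ 2 * β₁ / 2) * inner ℝ (T (V ω)) (V ω))) ∂P := by
        refine lintegral_mono fun ω => (hsubU _).trans (le_of_eq ?_)
        simp only [map_smul, real_inner_smul_left, real_inner_smul_right]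
        congr 2
        ring
    _ ≤ ENNReal.ofReal (Real.exp (2 * ((c ^ 2 * β₁ / 2) * β₂) * h)) :=
        lintegral_exp_quadratic_le e hV hT h0 hh (by positivity) hβ₂ hsubV (by linarith)
    _ = _ := by congr 2; ring

theorem lintegral_exp_chaos_le (hδ : ∀ i, Measurable (δ i)) (hind : iIndepFun δ P)
    (hT : T.IsPositive) {h : ℝ} (h0 : 0 ≤ h) (hh : hsNormSq e T ≤ ENNReal.ofReal h) (hβ : 0 ≤ β)
    (hsub : ∀ i z, ∫⁻ ω, ENNReal.ofReal (Real.exp (inner ℝ z (δ i ω))) ∂P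
      ≤ ENNReal.ofReal (Real.exp (β * inner ℝ (T z) z / 2)))
    (x y : Fin n → ℝ)
    (hsmall : 32 * β ^ 2 * (∑ i, x i ^ 2) * (∑ i, y i ^ 2) * ‖T‖ ^ 2 ≤ 1) :
    ∫⁻ ω, ENNReal.ofReal (Real.exp (chaos (fun i => δ i ω) x y)) ∂P
      ≤ ENNReal.ofReal (Real.exp (16 * β ^ 2 * (∑ i, x i ^ 2) * (∑ i, y i ^ 2) * h)) := by
  set X := ∑ i, x i ^ 2
  set Y := ∑ i, y i ^ 2
  have hX : 0 ≤ X := Finset.sum_nonneg fun _ _ => sq_nonneg _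
  have hY : 0 ≤ Y := Finset.sum_nonneg fun _ _ => sq_nonneg _
  have hsum : ∀ (w : Fin n → ℝ) (I : Finset (Fin n)), Measurable fun ω => ∑ i ∈ I, w i • δ i ω :=
    fun w I => Finset.measurable_sum _ fun i _ => (hδ i).const_smul (w i)
  have hle : ∀ (w : Fin n → ℝ) (I : Finset (Fin n)) (z : H),
      ∫⁻ ω, ENNReal.ofReal (Real.exp (inner ℝ z (∑ i ∈ I, w i • δ i ω))) ∂P
        ≤ ENNReal.ofReal (Real.exp ((β * ∑ i, w i ^ 2) * inner ℝ (T z) z / 2)) := by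
    intro w I z
    refine (lintegral_exp_inner_sum_le hδ hind hsub w I z).trans
      (ENNReal.ofReal_le_ofReal (Real.exp_le_exp.mpr ?_))
    have h1 : ∑ i ∈ I, w i ^ 2 ≤ ∑ i, w i ^ 2 :=
      Finset.sum_le_sum_of_subset_of_nonneg (Finset.subset_univ I) fun _ _ _ => sq_nonneg _
    have h2 := hT.inner_nonneg_left z
    gcongr
  have hI : ∀ I : Finset (Fin n), ∫⁻ ω, ENNReal.ofReal (Real.exp
      (4 * inner ℝ (∑ i ∈ I, x i • δ i ω) (∑ j ∈ Iᶜ, y j • δ j ω))) ∂P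
        ≤ ENNReal.ofReal (Real.exp (16 * β ^ 2 * X * Y * h)) := by
    intro I
    have hindep : IndepFun (fun ω => ∑ i ∈ I, x i • δ i ω) (fun ω => ∑ j ∈ Iᶜ, y j • δ j ω) P := by
      have h1 := hind.indepFun_finset I Iᶜ disjoint_compl_right hδ
      have h2 := h1.comp (φ := fun v : I → H => ∑ i : I, x i • v i)
        (ψ := fun v : (Iᶜ : Finset (Fin n)) → H => ∑ j : (Iᶜ : Finset (Fin n)), y j • v j)
        (by fun_prop) (by fun_prop)
      convert h2 using 1
      · ext ω
        exact (Finset.sum_coe_sort I fun i => x i • δ i ω).symm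
      · ext ω
        exact (Finset.sum_coe_sort Iᶜ fun i => y i • δ i ω).symm
    -- Decoupling forces `c = 4`, so the smallness condition becomes `16 β² X Y ‖T‖² ≤ 1/2`, which
    -- is `hsmall`.
    refine (lintegral_exp_inner_of_indepFun_le e (hsum x I) (hsum y Iᶜ) hindep hT h0 hh
      (mul_nonneg hβ hX) (mul_nonneg hβ hY) (hle x I) (hle y Iᶜ) 4 (by linarith)).trans
      (le_of_eq (by congr 2; ring))
  calc ∫⁻ ω, ENNReal.ofReal (Real.exp (chaos (fun i => δ i ω) x y)) ∂P
      ≤ ∫⁻ ω, ∑ I : Finset (Fin n), ENNReal.ofReal (2 ^ n : ℝ)⁻¹ * ENNReal.ofReal (Real.exp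
          (4 * inner ℝ (∑ i ∈ I, x i • δ i ω) (∑ j ∈ Iᶜ, y j • δ j ω))) ∂P := by
        refine lintegral_mono fun ω => ?_
        refine (ENNReal.ofReal_le_ofReal (exp_chaos_le _ x y)).trans (le_of_eq ?_)
        rw [ENNReal.ofReal_sum_of_nonneg fun _ _ => by positivity]
        exact Finset.sum_congr rfl fun I _ => ENNReal.ofReal_mul (by positivity)
    _ = ∑ I : Finset (Fin n), ENNReal.ofReal (2 ^ n : ℝ)⁻¹ * ∫⁻ ω, ENNReal.ofReal (Real.exp
          (4 * inner ℝ (∑ i ∈ I, x i • δ i ω) (∑ j ∈ Iᶜ, y j • δ j ω))) ∂P := by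
        have hm : ∀ I : Finset (Fin n), Measurable fun ω => ENNReal.ofReal (Real.exp
            (4 * inner ℝ (∑ i ∈ I, x i • δ i ω) (∑ j ∈ Iᶜ, y j • δ j ω))) := fun I =>
          (Real.measurable_exp.comp (((hsum x I).inner (hsum y Iᶜ)).const_mul 4)).ennreal_ofReal
        rw [lintegral_finsetSum _ fun I _ => (hm I).const_mul _]
        exact Finset.sum_congr rfl fun I _ => lintegral_const_mul _ (hm I)
    _ ≤ ∑ _I : Finset (Fin n), ENNReal.ofReal (2 ^ n : ℝ)⁻¹ *
          ENNReal.ofReal (Real.exp (16 * β ^ 2 * X * Y * h)) :=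
        Finset.sum_le_sum fun I _ => mul_le_mul_right (hI I) _
    _ = _ := by
        rw [Finset.sum_const, Finset.card_univ, Fintype.card_finset, Fintype.card_fin,
          nsmul_eq_mul, ← mul_assoc]
        have h1 : ((2 ^ n : ℕ) : ℝ≥0∞) = ENNReal.ofReal (2 ^ n : ℝ) := by
          rw [← ENNReal.ofReal_natCast]; norm_cast
        rw [h1, ← ENNReal.ofReal_mul (by positivity), mul_inv_cancel₀ (by positivity),
          ENNReal.ofReal_one, one_mul]

theorem measure_abs_chaos_ge_le (hδ : ∀ i, Measurable (δ i)) (hind : iIndepFun δ P)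
    (hT : T.IsPositive) {h : ℝ} (h0 : 0 ≤ h) (hh : hsNormSq e T ≤ ENNReal.ofReal h) (hβ : 0 ≤ β)
    (hsub : ∀ i z, ∫⁻ ω, ENNReal.ofReal (Real.exp (inner ℝ z (δ i ω))) ∂P
      ≤ ENNReal.ofReal (Real.exp (β * inner ℝ (T z) z / 2)))
    (x y : Fin n → ℝ) {ρ : ℝ} (hρ : (∑ i, x i ^ 2) * (∑ i, y i ^ 2) ≤ ρ) {t : ℝ} (ht : 0 ≤ t)
    (hsmall : 32 * t ^ 2 * β ^ 2 * ρ * ‖T‖ ^ 2 ≤ 1) (r : ℝ) :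
    P {ω | r ≤ |chaos (fun i => δ i ω) x y|}
      ≤ ENNReal.ofReal (2 * Real.exp (16 * t ^ 2 * β ^ 2 * ρ * h - t * r)) := by
  refine measure_abs_ge_le_of_lintegral_exp_le (measurable_chaos hδ x y) ht fun c hc => ?_
  have hc2 : c ^ 2 = t ^ 2 := by rw [← sq_abs, hc]
  have hsum : ∑ i, (c * x i) ^ 2 = t ^ 2 * ∑ i, x i ^ 2 := by
    rw [Finset.mul_sum]
    exact Finset.sum_congr rfl fun i _ => by rw [mul_pow, hc2]
  simp only [← chaos_smul_left]
  refine (lintegral_exp_chaos_le e hδ hind hT h0 hh hβ hsub _ y ?_).trans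
    (ENNReal.ofReal_le_ofReal (Real.exp_le_exp.mpr ?_))
  · rw [hsum]
    refine le_trans ?_ hsmall
    calc _ = 32 * t ^ 2 * β ^ 2 * ((∑ i, x i ^ 2) * ∑ i, y i ^ 2) * ‖T‖ ^ 2 := by ring
      _ ≤ _ := by gcongr
  · rw [hsum]
    calc _ = 16 * t ^ 2 * β ^ 2 * ((∑ i, x i ^ 2) * ∑ i, y i ^ 2) * h := by ring
      _ ≤ _ := by gcongr

end Chaos

/-! ### Monotonicity of the norms on positive operators. -/

section PositiveOperators

variable {H : Type*} [NormedAddCommGroup H] [InnerProductSpace ℝ H] {ι : Type*}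

theorem inner_apply_sq_le {S : H →L[ℝ] H} (hS : S.IsPositive) (x y : H) :
    inner ℝ (S x) y ^ 2 ≤ inner ℝ (S x) x * inner ℝ (S y) y := by
  have hsymm : ∀ x y, inner ℝ (S x) y = inner ℝ x (S y) := fun x y => hS.1 x y
  let B : LinearMap.BilinForm ℝ H := (innerₗ H) ∘ₗ (S : H →ₗ[ℝ] H)
  have h := B.apply_sq_le_of_symm (fun x => hS.inner_nonneg_left x) ⟨fun x y => by
    change inner ℝ (S x) y = inner ℝ (S y) x
    rw [hsymm, real_inner_comm]⟩ x y
  exact h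

/-- Cauchy-Schwarz for the form of `S` at `x` and `S x` gives `‖S x‖⁴ ≤ ⟨S x, x⟩ ⟨S (S x), S x⟩`,
and both factors are bounded by the form of `T`. -/
theorem opNorm_le_of_isPositive_sub {S T : H →L[ℝ] H} (hS : S.IsPositive)
    (hST : (T - S).IsPositive) : ‖S‖ ≤ ‖T‖ := by
  refine S.opNorm_le_bound (norm_nonneg _) fun x => ?_
  have hle : ∀ z, inner ℝ (S z) z ≤ ‖T‖ * ‖z‖ ^ 2 := fun z => by
    have h1 := hST.inner_nonneg_left z
    rw [_root_.sub_apply, inner_sub_left] at h1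
    calc inner ℝ (S z) z ≤ inner ℝ (T z) z := by linarith
      _ ≤ ‖T z‖ * ‖z‖ := real_inner_le_norm _ _
      _ ≤ ‖T‖ * ‖z‖ * ‖z‖ := by gcongr; exact T.le_opNorm z
      _ = _ := by ring
  have h1 := inner_apply_sq_le hS x (S x)
  have h2 : inner ℝ (S x) x * inner ℝ (S (S x)) (S x)
      ≤ (‖T‖ * ‖x‖ ^ 2) * (‖T‖ * ‖S x‖ ^ 2) :=
    mul_le_mul (hle x) (hle (S x)) (hS.inner_nonneg_left _) (by positivity)
  rw [real_inner_self_eq_norm_sq] at h1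
  rcases eq_or_ne (‖S x‖) 0 with h0 | h0
  · rw [h0]; positivity
  · have hpos : 0 < ‖S x‖ ^ 2 := by positivity
    have h3 : ‖S x‖ ^ 2 * ‖S x‖ ^ 2 ≤ (‖T‖ * ‖x‖) ^ 2 * ‖S x‖ ^ 2 := by
      calc _ = (‖S x‖ ^ 2) ^ 2 := by ring
        _ ≤ _ := h1.trans h2
        _ = _ := by ring
    exact abs_le_of_sq_le_sq' (le_of_mul_le_mul_right h3 hpos) (by positivity) |>.2

open Matrix in
/-- The trace of the square is monotone on positive semidefinite matrices. -/
theorem trace_mul_self_le_of_posSemidef {d : ℕ} {A B : Matrix (Fin d) (Fin d) ℝ}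
    (hA : A.PosSemidef) (hAB : (B - A).PosSemidef) : (A * A).trace ≤ (B * B).trace := by
  have hsum : (B + A).PosSemidef := by
    have := (hAB.add hA).add hA
    rwa [sub_add_cancel] at this
  obtain ⟨C, hC⟩ := exists_eq_transpose_mul_self hsum
  -- With `B + A = Cᵀ C` this is the trace of the positive semidefinite matrix `C (B - A) Cᵀ`.
  have h1 : 0 ≤ ((B - A) * (B + A)).trace := by
    rw [hC, ← Matrix.mul_assoc, trace_mul_comm, ← Matrix.mul_assoc,
      ← conjTranspose_eq_transpose_of_trivial]
    exact (hAB.mul_mul_conjTranspose_same C).trace_nonneg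
  rw [Matrix.sub_mul, Matrix.mul_add, Matrix.mul_add, trace_sub, trace_add, trace_add,
    trace_mul_comm A B] at h1
  linarith

open Matrix in
theorem posSemidef_of_isPositive {S : H →L[ℝ] H} (hS : S.IsPositive) {d : ℕ} (v : Fin d → H) :
    (Matrix.of fun i j => inner ℝ (S (v i)) (v j)).PosSemidef := by
  refine .of_dotProduct_mulVec_nonneg ?_ fun x => ?_
  · ext i j
    rw [conjTranspose_apply, of_apply, of_apply, star_trivial, real_inner_comm]
    exact (hS.1 (v i) (v j)).symm
  · have h := hS.inner_nonneg_left (∑ i, x i • v i)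
    simp only [map_sum, map_smul, sum_inner, inner_sum, real_inner_smul_left,
      real_inner_smul_right] at h
    simp only [dotProduct, mulVec, of_apply, star_trivial, Finset.mul_sum]
    rw [Finset.sum_comm]
    refine h.trans (le_of_eq ?_)
    exact Finset.sum_congr rfl fun i _ => Finset.sum_congr rfl fun j _ => by ring

theorem sum_inner_sq_le_of_isPositive_sub {S T : H →L[ℝ] H} (hS : S.IsPositive)
    (hST : (T - S).IsPositive) {d : ℕ} (v : Fin d → H) :
    ∑ i, ∑ j, inner ℝ (S (v i)) (v j) ^ 2 ≤ ∑ i, ∑ j, inner ℝ (T (v i)) (v j) ^ 2 := by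
  have hT : T.IsPositive := by simpa using hST.add hS
  have key : ∀ {R : H →L[ℝ] H}, R.IsPositive → ∑ i, ∑ j, inner ℝ (R (v i)) (v j) ^ 2
      = ((Matrix.of fun i j => inner ℝ (R (v i)) (v j)) *
        (Matrix.of fun i j => inner ℝ (R (v i)) (v j))).trace := by
    intro R hR
    rw [Matrix.trace]
    refine Finset.sum_congr rfl fun i _ => ?_
    rw [Matrix.diag, Matrix.mul_apply]
    refine Finset.sum_congr rfl fun j _ => ?_
    have h : inner ℝ (R (v i)) (v j) = inner ℝ (v i) (R (v j)) := hR.1 _ _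
    rw [Matrix.of_apply, Matrix.of_apply, pow_two]
    conv_lhs => rw [← real_inner_comm (R (v i)) (v j), ← real_inner_comm]
    conv_lhs => rw [h]
    rw [h, real_inner_comm (v i)]
  rw [key hS, key hT]
  refine trace_mul_self_le_of_posSemidef (posSemidef_of_isPositive hS v) ?_
  have := posSemidef_of_isPositive hST v
  convert this using 1
  ext i j
  simp [inner_sub_left]

theorem hsNormSq_eq_tsum (e : HilbertBasis ι ℝ H) (T : H →L[ℝ] H) :
    hsNormSq e T = ∑' i, ∑' j, ENNReal.ofReal (inner ℝ (T (e i)) (e j) ^ 2) := by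
  simp only [hsNormSq, enorm_sq_eq_tsum e, real_inner_comm]

/-- Any finite set of matrix entries lies in a finite principal block, where the claim is
monotonicity of the trace of the square. -/
theorem hsNormSq_le_of_isPositive_sub (e : HilbertBasis ι ℝ H) {S T : H →L[ℝ] H}
    (hS : S.IsPositive) (hST : (T - S).IsPositive) : hsNormSq e S ≤ hsNormSq e T := by
  classical
  rw [hsNormSq_eq_tsum, hsNormSq_eq_tsum, ← ENNReal.tsum_prod, ← ENNReal.tsum_prod,
    ENNReal.tsum_eq_iSup_sum]
  refine iSup_le fun F => ?_
  set G : Finset ι := F.image Prod.fst ∪ F.image Prod.snd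
  have hFG : F ⊆ G ×ˢ G := fun p hp => Finset.mem_product.mpr
    ⟨Finset.mem_union_left _ (Finset.mem_image_of_mem _ hp),
      Finset.mem_union_right _ (Finset.mem_image_of_mem _ hp)⟩
  have hG : ∀ R : H →L[ℝ] H, ∑ p ∈ G ×ˢ G, ENNReal.ofReal (inner ℝ (R (e p.1)) (e p.2) ^ 2)
      = ENNReal.ofReal (∑ i : Fin G.card, ∑ j : Fin G.card,
        inner ℝ (R (e (G.equivFin.symm i))) (e (G.equivFin.symm j)) ^ 2) := by
    intro R
    rw [← ENNReal.ofReal_sum_of_nonneg fun _ _ => sq_nonneg _, Finset.sum_product]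
    congr 1
    rw [← Finset.sum_coe_sort, ← Equiv.sum_comp G.equivFin.symm]
    refine Finset.sum_congr rfl fun i _ => ?_
    rw [← Finset.sum_coe_sort, ← Equiv.sum_comp G.equivFin.symm]
  calc _ ≤ ∑ p ∈ G ×ˢ G, ENNReal.ofReal (inner ℝ (S (e p.1)) (e p.2) ^ 2) :=
        Finset.sum_le_sum_of_subset hFG
    _ ≤ ∑ p ∈ G ×ˢ G, ENNReal.ofReal (inner ℝ (T (e p.1)) (e p.2) ^ 2) := by
        rw [hG, hG]
        exact ENNReal.ofReal_le_ofReal (sum_inner_sq_le_of_isPositive_sub hS hST _)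
    _ ≤ _ := ENNReal.sum_le_tsum _

/-- Balls of radius `1/2` about the basis vectors are disjoint. Countability permits exchanging
expectation and expansion in the basis. -/
theorem countable_of_hilbertBasis [TopologicalSpace.SeparableSpace H] (e : HilbertBasis ι ℝ H) :
    Countable ι := by
  have h : (Set.univ : Set ι).PairwiseDisjoint fun i => Metric.ball (e i) (1 / 2) := by
    intro i _ j _ hij
    apply Metric.ball_disjoint_ball
    have h1 : ‖e i - e j‖ ^ 2 = 2 := by
      have h0 : inner ℝ (e i) (e j) = (0 : ℝ) := e.orthonormal.2 hij
      rw [norm_sub_sq_real, h0, e.orthonormal.1, e.orthonormal.1]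
      norm_num
    rw [dist_eq_norm]
    nlinarith [norm_nonneg (e i - e j)]
  exact Set.countable_univ_iff.mp (h.countable_of_isOpen (fun i _ => Metric.isOpen_ball)
    fun i _ => ⟨e i, Metric.mem_ball_self (by norm_num)⟩)

end PositiveOperators

/-! ### The `ψ₂` norm as an admissible variance proxy. -/

section Psi2Norm

variable {H : Type*} [NormedAddCommGroup H] [InnerProductSpace ℝ H]
  {Ω : Type*} [MeasurableSpace Ω] {P : Measure Ω} {Z : Ω → H}

theorem integrable_inner_sq [IsProbabilityMeasure P] (hZ2 : MemLp Z 2 P) (z : H) :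
    Integrable (fun ω => inner ℝ z (Z ω - ∫ ω', Z ω' ∂P) ^ 2) P := by
  have hL : MemLp (fun ω => Z ω - ∫ ω', Z ω' ∂P) 2 P := hZ2.sub (memLp_const _)
  exact (hL.const_inner z).integrable_sq

theorem psi2Norm_nonneg (P : Measure Ω) (Z : Ω → H) (Γ : H →L[ℝ] H) : 0 ≤ psi2Norm P Z Γ :=
  Real.sInf_nonneg fun _ h => h.1

/-- The infimum is attained because, for each `z`, the condition on `α` is closed. -/
theorem subGaussianBound_psi2Norm {Γ : H →L[ℝ] H} (h : IsSubGaussian P Z Γ) :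
    SubGaussianBound P Z Γ (psi2Norm P Z Γ) := by
  have hmem : psi2Norm P Z Γ ∈ closure {α : ℝ | 0 ≤ α ∧ SubGaussianBound P Z Γ α} :=
    csInf_mem_closure h ⟨0, fun _ h => h.1⟩
  intro z
  have hcl : IsClosed {α : ℝ | ∫⁻ ω, ENNReal.ofReal (Real.exp (inner ℝ z (Z ω - ∫ ω', Z ω' ∂P))) ∂P
      ≤ ENNReal.ofReal (Real.exp (α ^ 2 * inner ℝ (Γ z) z / 2))} :=
    isClosed_le continuous_const (ENNReal.continuous_ofReal.comp (by fun_prop))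
  exact closure_minimal (fun α hα => hα.2 z) hcl hmem

end Psi2Norm

/-! ### Covariance operators and their relation to the variance proxy. -/

section Covariance

variable {H : Type*} [NormedAddCommGroup H] [InnerProductSpace ℝ H] [CompleteSpace H]
  [MeasurableSpace H] [BorelSpace H]
  {Ω : Type*} [MeasurableSpace Ω] {P : Measure Ω} [IsProbabilityMeasure P] {Z : Ω → H}

theorem inner_covOp [TopologicalSpace.SeparableSpace H] (hZ : Measurable Z) (hZ2 : MemLp Z 2 P)
    (z : H) : inner ℝ (covOp P Z z) z = ∫ ω, inner ℝ z (Z ω - ∫ ω', Z ω' ∂P) ^ 2 ∂P := by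
  have : SecondCountableTopology H := UniformSpace.secondCountable_of_separable H
  have hm : Measurable fun ω => Z ω - ∫ ω', Z ω' ∂P := hZ.sub_const _
  have hL : MemLp (fun ω => Z ω - ∫ ω', Z ω' ∂P) 2 P := hZ2.sub (memLp_const _)
  have : IsProbabilityMeasure (P.map fun ω => Z ω - ∫ ω', Z ω' ∂P) :=
    Measure.isProbabilityMeasure_map hm.aemeasurable
  rw [covOp, covarianceOperator_inner
    ((memLp_map_measure_iff aestronglyMeasurable_id hm.aemeasurable).mpr hL),
    integral_map hm.aemeasurable (by fun_prop)]
  simp only [pow_two]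

theorem lintegral_norm_sq_eq_posTraceNorm [TopologicalSpace.SeparableSpace H] {ι : Type*}
    (e : HilbertBasis ι ℝ H) (hZ : Measurable Z) (hZ2 : MemLp Z 2 P) :
    ∫⁻ ω, ENNReal.ofReal (‖Z ω - ∫ ω', Z ω' ∂P‖ ^ 2) ∂P = posTraceNorm e (covOp P Z) := by
  have : SecondCountableTopology H := UniformSpace.secondCountable_of_separable H
  have := countable_of_hilbertBasis e
  have hm : Measurable fun ω => Z ω - ∫ ω', Z ω' ∂P := hZ.sub_const _
  simp only [posTraceNorm, inner_covOp hZ hZ2]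
  have h1 : ∀ ω, ENNReal.ofReal (‖Z ω - ∫ ω', Z ω' ∂P‖ ^ 2)
      = ∑' j, ENNReal.ofReal (inner ℝ (e j) (Z ω - ∫ ω', Z ω' ∂P) ^ 2) := fun ω => by
    rw [← enorm_sq_eq_tsum, ENNReal.ofReal_pow (norm_nonneg _), ofReal_norm]
  simp only [h1]
  rw [lintegral_tsum fun j => by fun_prop]
  congr 1
  ext j
  rw [ofReal_integral_eq_lintegral_ofReal (integrable_inner_sq hZ2 (e j))
    (Filter.Eventually.of_forall fun _ => sq_nonneg _)]

/-- Equal trace norms thus give one number `γ` that centres all squared noise norms. -/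
theorem integral_norm_sq_eq_posTraceNorm [TopologicalSpace.SeparableSpace H] {ι : Type*}
    (e : HilbertBasis ι ℝ H) (hZ : Measurable Z) (hZ2 : MemLp Z 2 P) :
    ∫ ω, ‖Z ω - ∫ ω', Z ω' ∂P‖ ^ 2 ∂P = (posTraceNorm e (covOp P Z)).toReal := by
  have : SecondCountableTopology H := UniformSpace.secondCountable_of_separable H
  rw [← lintegral_norm_sq_eq_posTraceNorm e hZ hZ2,
    integral_eq_lintegral_of_nonneg_ae (Filter.Eventually.of_forall fun _ => sq_nonneg _)
      (by fun_prop)]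

theorem one_add_sq_div_two_le_cosh (x : ℝ) : 1 + x ^ 2 / 2 ≤ Real.cosh x := by
  have h1 : Real.cosh x = 1 + 2 * Real.sinh (x / 2) ^ 2 := by
    have := Real.cosh_two_mul (x / 2)
    rw [mul_div_cancel₀ x two_ne_zero, Real.cosh_sq] at this
    linarith
  have h2 : (x / 2) ^ 2 ≤ Real.sinh (x / 2) ^ 2 := by
    rw [sq_le_sq, Real.abs_sinh]
    exact Real.self_le_sinh_iff.mpr (abs_nonneg _)
  rw [h1]
  nlinarith

/-- A centred variable cannot be sub-gaussian with a variance proxy below its covariance. -/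
theorem covOp_eq_zero_or_one_le [TopologicalSpace.SeparableSpace H] (hZ : Measurable Z)
    (hZ2 : MemLp Z 2 P) (hpos : (covOp P Z).IsPositive) {α : ℝ} (hα : 0 ≤ α)
    (hsub : SubGaussianBound P Z (covOp P Z) α) : covOp P Z = 0 ∨ 1 ≤ α := by
  have : SecondCountableTopology H := UniformSpace.secondCountable_of_separable H
  by_contra! hcon
  obtain ⟨hne, hlt⟩ := hcon
  have hα2 : α ^ 2 < 1 := by nlinarith
  have hq : ∀ z, inner ℝ (covOp P Z z) z = 0 := by
    intro z
    by_contra hq0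
    have hqpos : 0 < inner ℝ (covOp P Z z) z :=
      lt_of_le_of_ne (hpos.inner_nonneg_left z) (Ne.symm hq0)
    set q := inner ℝ (covOp P Z z) z with hq
    -- Averaging the sub-gaussian bounds at `t z` and `-t z` bounds `E cosh (t Y)`, which is at
    -- least `1 + t² q / 2`; `t` is chosen to make this `1 + w`.
    have hmain : ∀ w : ℝ, 0 < w → 1 + w ≤ Real.exp (α ^ 2 * w) := by
      intro w hw
      set t := √(2 * w / q)
      have ht : t ^ 2 = 2 * w / q := Real.sq_sqrt (by positivity)
      set Y : Ω → ℝ := fun ω => inner ℝ z (Z ω - ∫ ω', Z ω' ∂P) with hY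
      have hYm : Measurable Y := by fun_prop
      have hb : ∀ c : ℝ, c ^ 2 = t ^ 2 →
          ∫⁻ ω, ENNReal.ofReal (Real.exp (c * Y ω)) ∂P
            ≤ ENNReal.ofReal (Real.exp (α ^ 2 * w)) := by
        intro c hc
        have h1 := hsub (c • z)
        simp only [map_smul, real_inner_smul_left, real_inner_smul_right] at h1
        refine h1.trans (le_of_eq ?_)
        congr 2
        rw [← hq]
        calc α ^ 2 * (c * (c * q)) / 2 = α ^ 2 * (c ^ 2 * q) / 2 := by ring
          _ = α ^ 2 * w := by rw [hc, ht]; field_simp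
      have hint : Integrable (fun ω => 1 + t ^ 2 / 2 * Y ω ^ 2) P :=
        (integrable_const _).add ((integrable_inner_sq hZ2 z).const_mul _)
      have h2 : ENNReal.ofReal (1 + w) = ∫⁻ ω, ENNReal.ofReal (1 + t ^ 2 / 2 * Y ω ^ 2) ∂P := by
        rw [← ofReal_integral_eq_lintegral_ofReal hint
          (Filter.Eventually.of_forall fun _ => by positivity),
          integral_add (integrable_const _) ((integrable_inner_sq hZ2 z).const_mul _),
          integral_const_mul, ← inner_covOp hZ hZ2, ← hq, ht]
        congr 1
        simp only [integral_const, probReal_univ, smul_eq_mul, mul_one]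
        field_simp
      have h3 : ENNReal.ofReal (1 + w) ≤ ENNReal.ofReal (Real.exp (α ^ 2 * w)) := by
        have h4 : ENNReal.ofReal (1 + w) ≤ ENNReal.ofReal (1 / 2) *
            (∫⁻ ω, ENNReal.ofReal (Real.exp (t * Y ω)) ∂P
              + ∫⁻ ω, ENNReal.ofReal (Real.exp (-t * Y ω)) ∂P) := by
          rw [h2, ← lintegral_add_left (by fun_prop), ← lintegral_const_mul _ (by fun_prop)]
          refine lintegral_mono fun ω => ?_
          rw [← ENNReal.ofReal_add (Real.exp_pos _).le (Real.exp_pos _).le,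
            ← ENNReal.ofReal_mul (by norm_num)]
          refine ENNReal.ofReal_le_ofReal ?_
          have := one_add_sq_div_two_le_cosh (t * Y ω)
          rw [Real.cosh_eq] at this
          rw [neg_mul]
          linarith
        refine h4.trans ((mul_le_mul_right (add_le_add (hb t rfl) (hb (-t) (by ring))) _).trans
          (le_of_eq ?_))
        rw [← ENNReal.ofReal_add (Real.exp_pos _).le (Real.exp_pos _).le,
            ← ENNReal.ofReal_mul (by norm_num)]
        congr 1
        ring
      exact (ENNReal.ofReal_le_ofReal_iff (Real.exp_pos _).le).mp h3
    -- With `exp s ≤ 1 / (1 - s)`, this choice of `w` turns `hmain` into `1 - α² ≤ α² (1 - α²) / 2`,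
    -- which is impossible for `α < 1`.
    have h5 := hmain ((1 - α ^ 2) / 2) (by linarith)
    have h6 : Real.exp (α ^ 2 * ((1 - α ^ 2) / 2))
        ≤ 1 / (1 - α ^ 2 * ((1 - α ^ 2) / 2)) := by
      have h7 := Real.one_sub_le_exp_neg (α ^ 2 * ((1 - α ^ 2) / 2))
      have h8 : 0 < 1 - α ^ 2 * ((1 - α ^ 2) / 2) := by nlinarith [sq_nonneg α]
      rw [le_div_iff₀ h8]
      calc _ ≤ Real.exp (α ^ 2 * ((1 - α ^ 2) / 2)) * Real.exp (-(α ^ 2 * ((1 - α ^ 2) / 2))) := by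
            gcongr
        _ = 1 := by rw [← Real.exp_add, add_neg_cancel, Real.exp_zero]
    have h8 : 0 < 1 - α ^ 2 * ((1 - α ^ 2) / 2) := by nlinarith [sq_nonneg α]
    have h9 := h5.trans h6
    rw [le_div_iff₀ h8] at h9
    nlinarith [sq_nonneg α, mul_pos (sub_pos.mpr hα2) (sub_pos.mpr hα2), mul_nonneg (sq_nonneg α) (sq_nonneg (1 - α ^ 2))]
  apply hne
  ext x
  have h1 := inner_apply_sq_le hpos x (covOp P Z x)
  rw [hq x, zero_mul] at h1
  have h2 : inner ℝ (covOp P Z x) (covOp P Z x) = 0 :=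
    pow_eq_zero_iff two_ne_zero |>.mp (le_antisymm h1 (sq_nonneg _))
  simpa using h2

end Covariance

/-! ### Discretization of the unit ball. -/

section Net

/-- The unit ball of a finite dimensional space has a `1/2`-net with at most `5 ^ dim` points. -/
theorem exists_finset_half_net (E : Type*) [NormedAddCommGroup E] [NormedSpace ℝ E]
    [FiniteDimensional ℝ E] :
    ∃ N : Finset E, N.card ≤ 5 ^ Module.finrank ℝ E ∧ (∀ x ∈ N, ‖x‖ ≤ 1) ∧
      ∀ x : E, ‖x‖ ≤ 1 → ∃ y ∈ N, ‖x - y‖ ≤ 1 / 2 := by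
  classical
  set p : ℕ → Prop := fun m => ∃ s : Finset E, s.card = m ∧ (∀ c ∈ s, ‖c‖ ≤ 1) ∧
    ∀ c ∈ s, ∀ d ∈ s, c ≠ d → 1 / 2 ≤ ‖c - d‖
  have hbound : ∀ s : Finset E, (∀ c ∈ s, ‖c‖ ≤ 1) →
      (∀ c ∈ s, ∀ d ∈ s, c ≠ d → 1 / 2 ≤ ‖c - d‖) → s.card ≤ 5 ^ Module.finrank ℝ E := by
    intro s h1 h2
    -- Doubling matches the normalization of the packing bound: separation 1 in the ball of radius
    -- 2.
    have hinj : Function.Injective fun x : E => (2 : ℝ) • x := smul_right_injective E two_ne_zero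
    rw [← Finset.card_image_of_injective s hinj]
    refine Besicovitch.card_le_of_separated _ ?_ ?_
    · intro c hc
      obtain ⟨x, hx, rfl⟩ := Finset.mem_image.mp hc
      rw [norm_smul, Real.norm_two]
      linarith [h1 x hx]
    · intro c hc d hd hcd
      obtain ⟨x, hx, rfl⟩ := Finset.mem_image.mp hc
      obtain ⟨y, hy, rfl⟩ := Finset.mem_image.mp hd
      have := h2 x hx y hy fun h => hcd (by rw [h])
      rw [← smul_sub, norm_smul, Real.norm_two]
      linarith
  -- A separated set of largest cardinality is a net, since a point far from it could be added.
  obtain ⟨N, hNc, hN1, hN2⟩ : p (Nat.findGreatest p (5 ^ Module.finrank ℝ E)) :=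
    Nat.findGreatest_spec (Nat.zero_le _) ⟨∅, by simp, by simp, by simp⟩
  refine ⟨N, hbound N hN1 hN2, hN1, fun x hx => ?_⟩
  by_contra! hfar
  have hxN : x ∉ N := fun h => by
    have := hfar x h
    rw [sub_self, norm_zero] at this
    linarith
  have h1 : ∀ c ∈ insert x N, ‖c‖ ≤ 1 := fun c hc => by
    rcases Finset.mem_insert.mp hc with rfl | h
    · exact hx
    · exact hN1 c h
  have h2 : ∀ c ∈ insert x N, ∀ d ∈ insert x N, c ≠ d → 1 / 2 ≤ ‖c - d‖ := by
    intro c hc d hd hcd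
    rcases Finset.mem_insert.mp hc with rfl | h
    · rcases Finset.mem_insert.mp hd with rfl | h'
      · exact absurd rfl hcd
      · exact (hfar d h').le
    · rcases Finset.mem_insert.mp hd with rfl | h'
      · rw [norm_sub_rev]
        exact (hfar c h).le
      · exact hN2 c h d h' hcd
  have hlt := Nat.le_findGreatest (P := p) (hbound _ h1 h2) ⟨_, rfl, h1, h2⟩
  rw [Finset.card_insert_of_notMem hxN, hNc] at hlt
  omega

/-- Each approximation, first of the test vector and then of the argument, leaves half of the norm
on the right and so costs a factor 2. -/
theorem opNorm_le_of_half_net {E : Type*} [NormedAddCommGroup E] [InnerProductSpace ℝ E]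
    {N : Set E} (hN : ∀ x : E, ‖x‖ ≤ 1 → ∃ y ∈ N, ‖x - y‖ ≤ 1 / 2) (f : E →L[ℝ] E) {M : ℝ}
    (hf : ∀ x ∈ N, ∀ y ∈ N, |inner ℝ x (f y)| ≤ M) : ‖f‖ ≤ 4 * M := by
  have hM : 0 ≤ M := by
    obtain ⟨y, hy, -⟩ := hN 0 (by simp)
    exact (abs_nonneg _).trans (hf y hy y hy)
  have hnorm : ∀ (v : E) (m : ℝ), 0 ≤ m → (∀ x ∈ N, |inner ℝ x v| ≤ m) → ‖v‖ ≤ 2 * m := by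
    intro v m hm h
    rcases eq_or_ne v 0 with rfl | hv
    · simpa using hm
    have hv0 : 0 < ‖v‖ := norm_pos_iff.mpr hv
    have hu : ‖‖v‖⁻¹ • v‖ = 1 := by
      rw [norm_smul, norm_inv, norm_norm, inv_mul_cancel₀ hv0.ne']
    obtain ⟨x, hx, hxu⟩ := hN (‖v‖⁻¹ • v) hu.le
    have h1 : inner ℝ (‖v‖⁻¹ • v) v = ‖v‖ := by
      rw [real_inner_smul_left, real_inner_self_eq_norm_sq]
      field_simp
    have h2 : inner ℝ (‖v‖⁻¹ • v) v = inner ℝ x v + inner ℝ (‖v‖⁻¹ • v - x) v := by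
      rw [← inner_add_left, add_sub_cancel]
    have h3 := le_of_abs_le (h x hx)
    have h4 : inner ℝ (‖v‖⁻¹ • v - x) v ≤ 1 / 2 * ‖v‖ :=
      (real_inner_le_norm _ _).trans (by gcongr)
    linarith
  have hfy : ∀ y ∈ N, ‖f y‖ ≤ 2 * M := fun y hy => hnorm _ M hM fun x hx => hf x hx y hy
  have hball : ‖f‖ ≤ 2 * M + ‖f‖ / 2 := by
    refine f.opNorm_le_of_unit_norm (by positivity) fun x hx => ?_
    obtain ⟨y, hy, hxy⟩ := hN x hx.le
    have h1 : f x = f y + f (x - y) := by rw [← map_add, add_sub_cancel]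
    rw [h1]
    refine (norm_add_le _ _).trans (add_le_add (hfy y hy) ?_)
    calc ‖f (x - y)‖ ≤ ‖f‖ * ‖x - y‖ := f.le_opNorm _
      _ ≤ ‖f‖ * (1 / 2) := by gcongr
      _ = _ := by ring
  linarith

theorem abs_chaos_le_of_half_net {H : Type*} [NormedAddCommGroup H] [InnerProductSpace ℝ H] {n : ℕ}
    {N : Set (EuclideanSpace ℝ (Fin n))} (hN : ∀ x, ‖x‖ ≤ 1 → ∃ y ∈ N, ‖x - y‖ ≤ 1 / 2)
    (δ : Fin n → H) {M : ℝ}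
    (h : ∀ x ∈ N, ∀ y ∈ N, |chaos δ (fun i => x i) (fun i => y i)| ≤ M) (v : Fin n → ℝ) :
    |chaos δ v v| ≤ 4 * M * ∑ i, v i ^ 2 := by
  set W : Matrix (Fin n) (Fin n) ℝ :=
    Matrix.of fun i j => if i = j then 0 else inner ℝ (δ i) (δ j) with hW
  set f := Matrix.toEuclideanCLM (𝕜 := ℝ) W
  have hf : ∀ x y : EuclideanSpace ℝ (Fin n),
      inner ℝ x (f y) = chaos δ (fun i => x i) (fun i => y i) := by
    intro x y
    rw [PiLp.inner_apply, chaos]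
    refine Finset.sum_congr rfl fun i _ => ?_
    have h1 : f y i = ∑ j, W i j * y j := by
      rw [Matrix.ofLp_toEuclideanCLM]
      rfl
    rw [h1, RCLike.inner_apply, conj_trivial, Finset.sum_mul]
    refine Finset.sum_congr rfl fun j _ => ?_
    rw [hW, Matrix.of_apply]
    split_ifs
    · simp
    · ring
  have hnorm := opNorm_le_of_half_net hN f fun x hx y hy => by rw [hf]; exact h x hx y hy
  have h1 := hf (WithLp.toLp 2 v) (WithLp.toLp 2 v)
  have h2 : ‖(WithLp.toLp 2 v : EuclideanSpace ℝ (Fin n))‖ ^ 2 = ∑ i, v i ^ 2 := by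
    rw [EuclideanSpace.norm_sq_eq]
    simp
  rw [← h2]
  change _ = chaos δ v v at h1
  rw [← h1]
  calc _ ≤ ‖(WithLp.toLp 2 v : EuclideanSpace ℝ (Fin n))‖ * ‖f (WithLp.toLp 2 v)‖ :=
        abs_real_inner_le_norm _ _
    _ ≤ ‖(WithLp.toLp 2 v : EuclideanSpace ℝ (Fin n))‖ *
          (‖f‖ * ‖(WithLp.toLp 2 v : EuclideanSpace ℝ (Fin n))‖) := by
        gcongr
        exact f.le_opNorm _
    _ = ‖f‖ * ‖(WithLp.toLp 2 v : EuclideanSpace ℝ (Fin n))‖ ^ 2 := by ring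
    _ ≤ _ := by gcongr

end Net

/-! ### Tails from moments of order at least three. -/

section Bernstein

open scoped Nat

/-- Moments are available only from order 3 on, so `1 + u + u²/2 ≤ 5/2 + 3/2 u³`, and `u³` is six
times the first term of the series: `9 + 1 = 10`. -/
theorem exp_le_add_tsum {u : ℝ} (hu : 0 ≤ u) :
    Real.exp u ≤ 5 / 2 + 10 * ∑' p : ℕ, u ^ (p + 3) / (p + 3)! := by
  have hs := NormedSpace.expSeries_div_hasSum_exp (𝔸 := ℝ) u
  rw [← Real.exp_eq_exp_ℝ] at hs
  have h1 := hs.summable.sum_add_tsum_nat_add 3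
  rw [hs.tsum_eq] at h1
  have hs3 : Summable fun p : ℕ => u ^ (p + 3) / ((p + 3)! : ℝ) :=
    (summable_nat_add_iff 3).mpr hs.summable
  have h2 := hs3.sum_le_tsum {0} fun _ _ => by positivity
  simp only [Finset.sum_singleton, zero_add] at h2
  generalize (∑' p : ℕ, u ^ (p + 3) / ((p + 3)! : ℝ)) = A at h1 h2 ⊢
  norm_num [Finset.sum_range_succ, Nat.factorial] at h1 h2
  have h3 : u ≤ 1 + u ^ 3 := by nlinarith [sq_nonneg (u - 1), mul_nonneg hu (sq_nonneg (u - 1))]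
  have h4 : u ^ 2 ≤ 1 + u ^ 3 := by
    nlinarith [sq_nonneg (u - 1), mul_nonneg hu (sq_nonneg (u - 1))]
  linarith

/-- The factorials cancel and leave a geometric series in `t κ ≤ 1/2`. A constant prefactor is
affordable because single variables, not sums, are estimated. -/
theorem lintegral_exp_abs_le_of_moments {Ω : Type*} [MeasurableSpace Ω] {P : Measure Ω}
    [IsProbabilityMeasure P] {Y : Ω → ℝ} (hY : Measurable Y) {C κ v : ℝ} (hC : 0 ≤ C) (hκ : 0 ≤ κ)
    (hv : 0 ≤ v)
    (hmom : ∀ q : ℕ, 3 ≤ q →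
      ∫⁻ ω, ENNReal.ofReal (|Y ω| ^ q) ∂P ≤ ENNReal.ofReal (C * q ! * κ ^ (q - 2) * v))
    {t : ℝ} (ht : 0 ≤ t) (htκ : t * κ ≤ 1 / 2) :
    ∫⁻ ω, ENNReal.ofReal (Real.exp (t * |Y ω|)) ∂P
      ≤ ENNReal.ofReal (5 / 2 + 10 * (C * t ^ 2 * v)) := by
  have hterm : ∀ p : ℕ, ∫⁻ ω, ENNReal.ofReal ((t * |Y ω|) ^ (p + 3) / (p + 3)!) ∂P
      ≤ ENNReal.ofReal (C * t ^ 2 * v * (1 / 2 / 2 ^ p)) := by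
    intro p
    have e1 : ∀ ω, ENNReal.ofReal ((t * |Y ω|) ^ (p + 3) / (p + 3)!)
        = ENNReal.ofReal (t ^ (p + 3) / (p + 3)!) * ENNReal.ofReal (|Y ω| ^ (p + 3)) := by
      intro ω
      rw [← ENNReal.ofReal_mul (by positivity)]
      congr 1
      ring
    simp only [e1]
    rw [lintegral_const_mul _ (by fun_prop)]
    refine (mul_le_mul_right (hmom (p + 3) (by omega)) _).trans ?_
    rw [← ENNReal.ofReal_mul (by positivity)]
    refine ENNReal.ofReal_le_ofReal ?_
    have e2 : t ^ (p + 3) / ((p + 3)! : ℝ) * (C * ((p + 3)! : ℝ) * κ ^ (p + 3 - 2) * v)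
        = C * t ^ 2 * v * (t * κ) ^ (p + 1) := by
      have : ((p + 3)! : ℝ) ≠ 0 := Nat.cast_ne_zero.mpr (Nat.factorial_ne_zero _)
      rw [show p + 3 - 2 = p + 1 by omega]
      field_simp
      ring
    rw [e2]
    refine mul_le_mul_of_nonneg_left ?_ (by positivity)
    calc (t * κ) ^ (p + 1) ≤ (1 / 2) ^ (p + 1) := pow_le_pow_left₀ (by positivity) htκ _
      _ = _ := by rw [pow_succ, one_div_pow]; ring
  have hsum : HasSum (fun p : ℕ => C * t ^ 2 * v * (1 / 2 / 2 ^ p)) (C * t ^ 2 * v) := by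
    have := (hasSum_geometric_two' (1 : ℝ)).mul_left (C * t ^ 2 * v)
    simpa using this
  have hpt : ∀ ω, ENNReal.ofReal (Real.exp (t * |Y ω|)) ≤ ENNReal.ofReal (5 / 2)
      + ENNReal.ofReal 10 * ∑' p : ℕ, ENNReal.ofReal ((t * |Y ω|) ^ (p + 3) / (p + 3)!) := by
    intro ω
    have hu : 0 ≤ t * |Y ω| := by positivity
    have hs3 : Summable fun p : ℕ => (t * |Y ω|) ^ (p + 3) / ((p + 3)! : ℝ) :=
      (summable_nat_add_iff 3).mpr (NormedSpace.expSeries_div_hasSum_exp (𝔸 := ℝ) _).summable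
    rw [← ENNReal.ofReal_tsum_of_nonneg (fun _ => by positivity) hs3,
      ← ENNReal.ofReal_mul (by norm_num), ← ENNReal.ofReal_add (by norm_num)
        (mul_nonneg (by norm_num) (tsum_nonneg fun _ => by positivity))]
    exact ENNReal.ofReal_le_ofReal (exp_le_add_tsum hu)
  calc ∫⁻ ω, ENNReal.ofReal (Real.exp (t * |Y ω|)) ∂P
      ≤ ∫⁻ ω, (ENNReal.ofReal (5 / 2) + ENNReal.ofReal 10 *
          ∑' p : ℕ, ENNReal.ofReal ((t * |Y ω|) ^ (p + 3) / (p + 3)!)) ∂P := lintegral_mono hpt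
    _ = ENNReal.ofReal (5 / 2) + ENNReal.ofReal 10 *
          ∑' p : ℕ, ∫⁻ ω, ENNReal.ofReal ((t * |Y ω|) ^ (p + 3) / (p + 3)!) ∂P := by
        rw [lintegral_add_left measurable_const, lintegral_const_mul, lintegral_tsum]
        · simp
        · intro p
          fun_prop
        · fun_prop
    _ ≤ ENNReal.ofReal (5 / 2) + ENNReal.ofReal 10 *
          ∑' p : ℕ, ENNReal.ofReal (C * t ^ 2 * v * (1 / 2 / 2 ^ p)) := by
        gcongr with p
        exact hterm p
    _ = _ := by
        rw [← ENNReal.ofReal_tsum_of_nonneg (fun _ => by positivity) hsum.summable, hsum.tsum_eq,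
          ← ENNReal.ofReal_mul (by norm_num), ← ENNReal.ofReal_add (by norm_num) (by positivity)]

theorem measure_abs_ge_le_of_moments {Ω : Type*} [MeasurableSpace Ω] {P : Measure Ω}
    [IsProbabilityMeasure P] {Y : Ω → ℝ} (hY : Measurable Y) {C κ v : ℝ} (hC : 0 ≤ C) (hκ : 0 ≤ κ)
    (hv : 0 ≤ v)
    (hmom : ∀ q : ℕ, 3 ≤ q →
      ∫⁻ ω, ENNReal.ofReal (|Y ω| ^ q) ∂P ≤ ENNReal.ofReal (C * q ! * κ ^ (q - 2) * v))
    {t : ℝ} (ht : 0 ≤ t) (htκ : t * κ ≤ 1 / 2) (r : ℝ) :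
    P {ω | r ≤ |Y ω|}
      ≤ ENNReal.ofReal ((5 / 2 + 10 * (C * t ^ 2 * v)) * Real.exp (-(t * r))) := by
  have hpos : 0 < 5 / 2 + 10 * (C * t ^ 2 * v) := by positivity
  have h := measure_ge_le_of_lintegral_exp_le (f := fun ω => |Y ω|) (r := r) (P := P)
    (B := Real.log (5 / 2 + 10 * (C * t ^ 2 * v))) (by fun_prop) ht (by
      rw [Real.exp_log hpos]
      exact lintegral_exp_abs_le_of_moments hY hC hκ hv hmom ht htκ)
  rwa [sub_eq_add_neg, Real.exp_add, Real.exp_log hpos] at h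

end Bernstein

/-! ### Splitting the centred Gram matrix into chaos and diagonal. -/

section CentredGram

open Matrix

variable {H : Type*} [NormedAddCommGroup H] [InnerProductSpace ℝ H] {n K : ℕ} {σ : Fin n → Fin K}

theorem dotProduct_centredGram_mulVec (δ : Fin n → H) (γ : ℝ) (v : Fin n → ℝ) :
    v ⬝ᵥ centredGram δ γ *ᵥ v = chaos δ v v + ∑ i, v i ^ 2 * (‖δ i‖ ^ 2 - γ) := by
  simp only [dotProduct, mulVec, chaos]
  rw [← Finset.sum_add_distrib]
  refine Finset.sum_congr rfl fun i _ => ?_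
  have h1 : v i ^ 2 * (‖δ i‖ ^ 2 - γ) = ∑ j, if i = j then v i ^ 2 * (‖δ i‖ ^ 2 - γ) else 0 := by
    simp
  rw [h1, ← Finset.sum_add_distrib, Finset.mul_sum]
  refine Finset.sum_congr rfl fun j _ => ?_
  by_cases hij : i = j
  · subst hij
    simp only [centredGram, of_apply, if_true, real_inner_self_eq_norm_sq]
    ring
  · simp only [centredGram, of_apply, hij, if_false]
    ring

theorem centredGram_mul_blockMatrix_apply (δ : Fin n → H) (γ : ℝ) (i j : Fin n) :
    (centredGram δ γ * blockMatrix σ) i j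
      = chaos δ (Pi.single i 1) (fun l => blockMatrix σ l j)
        + blockMatrix σ i j * (‖δ i‖ ^ 2 - γ) := by
  have h0 : chaos δ (Pi.single i 1) (fun l => blockMatrix σ l j)
      = ∑ l, if i = l then 0 else blockMatrix σ l j * inner ℝ (δ i) (δ l) := by
    rw [chaos, Finset.sum_eq_single i]
    · exact Finset.sum_congr rfl fun l _ => by simp
    · intro k _ hk
      refine Finset.sum_eq_zero fun l _ => ?_
      simp [Pi.single_eq_of_ne hk]
    · simp
  have h1 : blockMatrix σ i j * (‖δ i‖ ^ 2 - γ)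
      = ∑ l, if i = l then blockMatrix σ i j * (‖δ i‖ ^ 2 - γ) else 0 := by simp
  rw [h0, h1, ← Finset.sum_add_distrib, mul_apply]
  refine Finset.sum_congr rfl fun l _ => ?_
  by_cases hil : i = l
  · subst hil
    simp only [centredGram, of_apply, if_true, real_inner_self_eq_norm_sq]
    ring
  · simp only [centredGram, of_apply, hil, if_false]
    ring

/-- This is a diagonal entry of `P * P = P`. -/
theorem sum_blockMatrix_sq (j : Fin n) :
    ∑ l, blockMatrix σ l j ^ 2 = ((cluster σ (σ j)).card : ℝ)⁻¹ := by
  have h := congr_fun (congr_fun (blockMatrix_mul_self σ) j) j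
  rw [mul_apply, blockMatrix_apply σ j j, if_pos rfl] at h
  rw [← h]
  exact Finset.sum_congr rfl fun l _ => by rw [pow_two, blockMatrix_symm σ j l]

theorem inv_card_cluster_le (hσ : Function.Surjective σ) (hK : 1 ≤ K) (k : Fin K) :
    ((cluster σ k).card : ℝ)⁻¹ ≤ (minSize σ : ℝ)⁻¹ :=
  inv_anti₀ (Nat.cast_pos.mpr (minSize_pos hσ hK)) (Nat.cast_le.mpr (minSize_le σ k))

theorem blockMatrix_le (hσ : Function.Surjective σ) (hK : 1 ≤ K) (i j : Fin n) :
    blockMatrix σ i j ≤ (minSize σ : ℝ)⁻¹ := by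
  rw [blockMatrix_apply]
  split_ifs
  · exact inv_card_cluster_le hσ hK _
  · positivity

/-- A deterministic sufficient condition for exact recovery. -/
theorem eq_blockMatrix_of_bounds (hσ : Function.Surjective σ) (hK : 1 ≤ K)
    (μ : Fin K → H) (δ : Fin n → H) (γ Δ : ℝ) (hΔ : 0 < Δ)
    (hsep : ∀ k l, k ≠ l → Δ ≤ ‖μ k - μ l‖)
    {N : Set (EuclideanSpace ℝ (Fin n))} (hN : ∀ x, ‖x‖ ≤ 1 → ∃ y ∈ N, ‖x - y‖ ≤ 1 / 2)
    (hlin : ∀ i l, |inner ℝ (δ i) (μ l - μ (σ i))| ≤ ‖μ l - μ (σ i)‖ ^ 2 / 16)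
    (havg : ∀ i j, |chaos δ (Pi.single i 1) (fun l => blockMatrix σ l j)| ≤ Δ ^ 2 / 64)
    (hnet : ∀ x ∈ N, ∀ y ∈ N,
      |chaos δ (fun i => x i) (fun i => y i)| ≤ minSize σ * Δ ^ 2 / 256)
    (hdiag : ∀ i, |‖δ i‖ ^ 2 - γ| ≤ minSize σ * Δ ^ 2 / 64)
    {Z : Matrix (Fin n) (Fin n) ℝ}
    (hZ : IsSDPSolution K (Matrix.gram ℝ fun i => μ (σ i) + δ i) Z) : Z = blockMatrix σ := by
  have hM : (0 : ℝ) < minSize σ := Nat.cast_pos.mpr (minSize_pos hσ hK)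
  refine eq_blockMatrix_of_isSDPSolution hσ hK μ δ γ Δ hΔ hsep hlin (fun i j => ?_) (fun v => ?_) hZ
  · rw [centredGram_mul_blockMatrix_apply]
    have h1 : |blockMatrix σ i j * (‖δ i‖ ^ 2 - γ)| ≤ Δ ^ 2 / 64 := by
      rw [abs_mul, abs_of_nonneg (blockMatrix_nonneg σ i j)]
      calc _ ≤ (minSize σ : ℝ)⁻¹ * (minSize σ * Δ ^ 2 / 64) :=
            mul_le_mul (blockMatrix_le hσ hK i j) (hdiag i) (abs_nonneg _) (by positivity)
        _ = _ := by field_simp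
    have h2 := abs_add_le (chaos δ (Pi.single i 1) (fun l => blockMatrix σ l j))
      (blockMatrix σ i j * (‖δ i‖ ^ 2 - γ))
    linarith [havg i j]
  · rw [dotProduct_centredGram_mulVec]
    have h1 := abs_chaos_le_of_half_net hN δ hnet v
    have h2 : |∑ i, v i ^ 2 * (‖δ i‖ ^ 2 - γ)| ≤ minSize σ * Δ ^ 2 / 64 * ∑ i, v i ^ 2 := by
      rw [Finset.mul_sum]
      refine (Finset.abs_sum_le_sum_abs _ _).trans (Finset.sum_le_sum fun i _ => ?_)
      rw [abs_mul, abs_of_nonneg (sq_nonneg (v i)), mul_comm]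
      exact mul_le_mul_of_nonneg_right (hdiag i) (sq_nonneg _)
    have h3 : v ⬝ᵥ v = ∑ i, v i ^ 2 := Finset.sum_congr rfl fun i _ => by rw [pow_two]
    rw [h3]
    refine (abs_add_le _ _).trans ((add_le_add h1 h2).trans (le_of_eq ?_))
    ring

end CentredGram

/-! ### Union bound. -/

section UnionBound

variable {Ω : Type*} [MeasurableSpace Ω] {P : Measure Ω}

theorem measure_biUnion_finset_le_ofReal {κ : Type*} (s : Finset κ) (E : κ → Set Ω) {a c : ℝ}
    (ha : 0 ≤ a) (hc : (s.card : ℝ) ≤ c) (hE : ∀ k ∈ s, P (E k) ≤ ENNReal.ofReal a) :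
    P (⋃ k ∈ s, E k) ≤ ENNReal.ofReal (c * a) := by
  refine (measure_biUnion_finset_le s E).trans ((Finset.sum_le_sum hE).trans ?_)
  rw [Finset.sum_const, nsmul_eq_mul, ← ENNReal.ofReal_natCast,
    ← ENNReal.ofReal_mul (Nat.cast_nonneg _)]
  exact ENNReal.ofReal_le_ofReal (mul_le_mul_of_nonneg_right hc ha)

end UnionBound

/-! ### Tail bounds at the scales set by the signal-to-noise ratio. -/

section Tails

variable {H : Type*} [NormedAddCommGroup H] [InnerProductSpace ℝ H]
  [MeasurableSpace H] [BorelSpace H] [SecondCountableTopology H]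
  {Ω : Type*} [MeasurableSpace Ω] {P : Measure Ω} {T : H →L[ℝ] H} {β h Λ Δ : ℝ}

theorem measure_abs_inner_ge_le {δ : Ω → H} (hδ : Measurable δ) (hβ : 0 ≤ β) (hΛ : 0 ≤ Λ)
    (hsub : ∀ z, ∫⁻ ω, ENNReal.ofReal (Real.exp (inner ℝ z (δ ω))) ∂P
      ≤ ENNReal.ofReal (Real.exp (β * inner ℝ (T z) z / 2)))
    (hΔ : 0 < Δ) (hsnr : 2 ^ 27 * Λ * (β * ‖T‖) ≤ Δ ^ 2) {z : H} (hz : Δ ≤ ‖z‖) :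
    P {ω | ‖z‖ ^ 2 / 16 ≤ |inner ℝ (δ ω) z|} ≤ ENNReal.ofReal (2 * Real.exp (-(4 * Λ))) := by
  have hs : 0 < ‖z‖ := hΔ.trans_le hz
  -- Here `t * ‖z‖² / 16 = 5 Λ`, while the exponential moment costs at most `Λ`.
  set t := 80 * Λ / ‖z‖ ^ 2 with ht
  have hsnr' : 2 ^ 27 * Λ * (β * ‖T‖) ≤ ‖z‖ ^ 2 := hsnr.trans (pow_le_pow_left₀ hΔ.le hz 2)
  refine (measure_abs_ge_le_of_lintegral_exp_le (t := t) (B := Λ) (by fun_prop) (by positivity)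
    fun c hc => ?_).trans (le_of_eq ?_)
  · have h1 := hsub (c • z)
    simp only [map_smul, real_inner_smul_left, real_inner_smul_right] at h1
    simp only [real_inner_comm z]
    refine h1.trans (ENNReal.ofReal_le_ofReal (Real.exp_le_exp.mpr ?_))
    have h2 : inner ℝ (T z) z ≤ ‖T‖ * ‖z‖ ^ 2 := by
      calc inner ℝ (T z) z ≤ ‖T z‖ * ‖z‖ := real_inner_le_norm _ _
        _ ≤ ‖T‖ * ‖z‖ * ‖z‖ := by gcongr; exact T.le_opNorm z
        _ = _ := by ring
    have hc2 : c ^ 2 = t ^ 2 := by rw [← sq_abs, hc]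
    have h3 : Λ * (β * ‖T‖) / ‖z‖ ^ 2 ≤ 1 / 2 ^ 27 := by
      rw [div_le_div_iff₀ (by positivity) (by positivity)]
      linarith
    calc β * (c * (c * inner ℝ (T z) z)) / 2 = β * t ^ 2 / 2 * inner ℝ (T z) z := by
          rw [← hc2]; ring
      _ ≤ β * t ^ 2 / 2 * (‖T‖ * ‖z‖ ^ 2) := by gcongr
      _ = 3200 * Λ * (Λ * (β * ‖T‖) / ‖z‖ ^ 2) := by rw [ht]; field_simp; ring
      _ ≤ 3200 * Λ * (1 / 2 ^ 27) := mul_le_mul_of_nonneg_left h3 (by positivity)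
      _ ≤ Λ := by linarith
  · congr 3
    rw [ht]
    field_simp
    ring

variable [IsProbabilityMeasure P] {ι : Type*} (e : HilbertBasis ι ℝ H) {n : ℕ} {δ : Fin n → Ω → H}
  {M : ℝ}

theorem measure_abs_chaos_ge_le_of_log (hδ : ∀ i, Measurable (δ i)) (hind : iIndepFun δ P)
    (hT : T.IsPositive) (h0 : 0 ≤ h) (hh : hsNormSq e T ≤ ENNReal.ofReal h) (hβ : 0 ≤ β)
    (hsub : ∀ i z, ∫⁻ ω, ENNReal.ofReal (Real.exp (inner ℝ z (δ i ω))) ∂P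
      ≤ ENNReal.ofReal (Real.exp (β * inner ℝ (T z) z / 2)))
    (hΛ : 0 ≤ Λ) (hΔ : 0 < Δ) (hM : 1 ≤ M) (hsnr : 2 ^ 27 * Λ * (β * ‖T‖) ≤ Δ ^ 2)
    (hsnr' : 2 ^ 27 * Λ * (β ^ 2 * h) ≤ M * Δ ^ 4)
    (x y : Fin n → ℝ) (hxy : (∑ i, x i ^ 2) * (∑ i, y i ^ 2) ≤ M⁻¹) :
    P {ω | Δ ^ 2 / 64 ≤ |chaos (fun i => δ i ω) x y|}
      ≤ ENNReal.ofReal (2 * Real.exp (-(4 * Λ))) := by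
  have hM0 : 0 < M := by linarith
  -- Again `t * Δ² / 64 = 5 Λ`, against a cost of at most `Λ`.
  set t := 320 * Λ / Δ ^ 2 with ht
  have h1 : Λ * (β * ‖T‖) / Δ ^ 2 ≤ 1 / 2 ^ 27 := by
    rw [div_le_div_iff₀ (by positivity) (by positivity)]
    linarith
  have h2 : Λ * (β ^ 2 * h) / (M * Δ ^ 4) ≤ 1 / 2 ^ 27 := by
    rw [div_le_div_iff₀ (by positivity) (by positivity)]
    linarith
  refine (measure_abs_chaos_ge_le e hδ hind hT h0 hh hβ hsub x y hxy (t := t) (by positivity) ?_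
    _).trans (ENNReal.ofReal_le_ofReal (mul_le_mul_of_nonneg_left (Real.exp_le_exp.mpr ?_)
      zero_le_two))
  · calc 32 * t ^ 2 * β ^ 2 * M⁻¹ * ‖T‖ ^ 2
        = 3276800 * (Λ * (β * ‖T‖) / Δ ^ 2) ^ 2 * M⁻¹ := by rw [ht]; field_simp; ring
      _ ≤ 3276800 * (1 / 2 ^ 27) ^ 2 * 1 := by
          gcongr
          exact inv_le_one_of_one_le₀ hM
      _ ≤ 1 := by norm_num
  · have h3 : t * (Δ ^ 2 / 64) = 5 * Λ := by rw [ht]; field_simp; ring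
    have h4 : 16 * t ^ 2 * β ^ 2 * M⁻¹ * h ≤ Λ := by
      calc 16 * t ^ 2 * β ^ 2 * M⁻¹ * h
          = 1638400 * Λ * (Λ * (β ^ 2 * h) / (M * Δ ^ 4)) := by rw [ht]; field_simp; ring
        _ ≤ 1638400 * Λ * (1 / 2 ^ 27) := by gcongr
        _ ≤ Λ := by linarith
    linarith

theorem measure_abs_chaos_ge_le_of_card (hδ : ∀ i, Measurable (δ i)) (hind : iIndepFun δ P)
    (hT : T.IsPositive) (h0 : 0 ≤ h) (hh : hsNormSq e T ≤ ENNReal.ofReal h) (hβ : 0 ≤ β)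
    (hsub : ∀ i z, ∫⁻ ω, ENNReal.ofReal (Real.exp (inner ℝ z (δ i ω))) ∂P
      ≤ ENNReal.ofReal (Real.exp (β * inner ℝ (T z) z / 2)))
    (hΔ : 0 < Δ) (hM : 1 ≤ M) (hsnr : 2 ^ 27 * n * (β * ‖T‖) ≤ M * Δ ^ 2)
    (hsnr' : 2 ^ 27 * n * (β ^ 2 * h) ≤ M ^ 2 * Δ ^ 4)
    (x y : Fin n → ℝ) (hxy : (∑ i, x i ^ 2) * (∑ i, y i ^ 2) ≤ 1) :
    P {ω | M * Δ ^ 2 / 256 ≤ |chaos (fun i => δ i ω) x y|}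
      ≤ ENNReal.ofReal (2 * Real.exp (-(7 * n))) := by
  have hM0 : 0 < M := by linarith
  -- As `2048 = 8 * 256`, the gain is `8 n` against a cost of at most `n`. The constant `2 ^ 27` of
  -- the hypotheses is `32 * 2048 ^ 2`.
  set t := 2048 * n / (M * Δ ^ 2) with ht
  have h1 : n * (β * ‖T‖) / (M * Δ ^ 2) ≤ 1 / 2 ^ 27 := by
    rw [div_le_div_iff₀ (by positivity) (by positivity)]
    linarith
  have h2 : n * (β ^ 2 * h) / (M ^ 2 * Δ ^ 4) ≤ 1 / 2 ^ 27 := by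
    rw [div_le_div_iff₀ (by positivity) (by positivity)]
    linarith
  refine (measure_abs_chaos_ge_le e hδ hind hT h0 hh hβ hsub x y hxy (t := t) (by positivity) ?_
    _).trans (ENNReal.ofReal_le_ofReal (mul_le_mul_of_nonneg_left (Real.exp_le_exp.mpr ?_)
      zero_le_two))
  · calc 32 * t ^ 2 * β ^ 2 * 1 * ‖T‖ ^ 2
        = 134217728 * (n * (β * ‖T‖) / (M * Δ ^ 2)) ^ 2 := by rw [ht]; field_simp; ring
      _ ≤ 134217728 * (1 / 2 ^ 27) ^ 2 := by gcongr
      _ ≤ 1 := by norm_num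
  · have h3 : t * (M * Δ ^ 2 / 256) = 8 * n := by rw [ht]; field_simp; ring
    have h4 : 16 * t ^ 2 * β ^ 2 * 1 * h ≤ (n : ℝ) := by
      calc 16 * t ^ 2 * β ^ 2 * 1 * h
          = 67108864 * (n : ℝ) * (n * (β ^ 2 * h) / (M ^ 2 * Δ ^ 4)) := by rw [ht]; field_simp; ring
        _ ≤ 67108864 * (n : ℝ) * (1 / 2 ^ 27) := by gcongr
        _ ≤ (n : ℝ) := by linarith [(Nat.cast_nonneg n : (0 : ℝ) ≤ n)]
    linarith

-- The decay `exp (-5 Λ)` leaves room for the linear prefactor in `Λ` that the moment method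
-- produces.
open scoped Nat in
omit [MeasurableSpace H] [BorelSpace H] [SecondCountableTopology H] in
theorem measure_abs_ge_le_of_bernstein {Y : Ω → ℝ} (hY : Measurable Y) {C : ℝ} (hC : 0 ≤ C)
    (h0 : 0 ≤ h) (hβ : 0 ≤ β)
    (hmom : ∀ q : ℕ, 3 ≤ q → ∫⁻ ω, ENNReal.ofReal (|Y ω| ^ q) ∂P
      ≤ ENNReal.ofReal (C * q ! * (β * ‖T‖) ^ (q - 2) * (β ^ 2 * h)))
    (hΛ : 0 ≤ Λ) (hΔ : 0 < Δ) (hM : 1 ≤ M) (hsnr : 2 ^ 27 * Λ * (β * ‖T‖) ≤ Δ ^ 2)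
    (hsnr' : 2 ^ 27 * Λ * (β ^ 2 * h) ≤ M * Δ ^ 4) :
    P {ω | M * Δ ^ 2 / 64 ≤ |Y ω|}
      ≤ ENNReal.ofReal ((5 / 2 + 10 * (C * Λ)) * Real.exp (-(5 * Λ))) := by
  have hM0 : 0 < M := by linarith
  set t := 320 * Λ / (M * Δ ^ 2) with ht
  have h1 : Λ * (β * ‖T‖) / Δ ^ 2 ≤ 1 / 2 ^ 27 := by
    rw [div_le_div_iff₀ (by positivity) (by positivity)]
    linarith
  have h2 : Λ * (β ^ 2 * h) / (M * Δ ^ 4) ≤ 1 / 2 ^ 27 := by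
    rw [div_le_div_iff₀ (by positivity) (by positivity)]
    linarith
  have hMi : M⁻¹ ≤ 1 := inv_le_one_of_one_le₀ hM
  refine (measure_abs_ge_le_of_moments hY hC (by positivity) (by positivity) hmom (t := t)
    (by positivity) ?_ _).trans (ENNReal.ofReal_le_ofReal ?_)
  · calc t * (β * ‖T‖) = 320 * (Λ * (β * ‖T‖) / Δ ^ 2) * M⁻¹ := by rw [ht]; field_simp
      _ ≤ 320 * (1 / 2 ^ 27) * 1 := by gcongr
      _ ≤ 1 / 2 := by norm_num
  · have h3 : t * (M * Δ ^ 2 / 64) = 5 * Λ := by rw [ht]; field_simp; ring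
    have h4 : t ^ 2 * (β ^ 2 * h) ≤ Λ := by
      calc t ^ 2 * (β ^ 2 * h)
          = 102400 * Λ * (Λ * (β ^ 2 * h) / (M * Δ ^ 4)) * M⁻¹ := by rw [ht]; field_simp; ring
        _ ≤ 102400 * Λ * (1 / 2 ^ 27) * 1 := by gcongr
        _ ≤ Λ := by linarith
    rw [h3, mul_assoc C]
    gcongr

end Tails

/-! ### The event of exact recovery. -/

section Event

theorem exp_neg_mul_log {n : ℕ} (hn : 1 ≤ n) (k : ℕ) :
    Real.exp (-(k * Real.log n)) = 1 / (n : ℝ) ^ k := by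
  have hn0 : (0 : ℝ) < n := by exact_mod_cast hn
  rw [Real.exp_neg, Real.exp_nat_mul, Real.exp_log hn0, one_div]

/-- There are at most `25 ^ n ≤ exp (5 n)` pairs of net points, so `exp (-2 n) ≤ n⁻²` remains. -/
theorem pow_mul_exp_neg_le {n : ℕ} (hn : 1 ≤ n) :
    (25 : ℝ) ^ n * (2 * Real.exp (-(7 * n))) ≤ 2 / (n : ℝ) ^ 2 := by
  have hn0 : (0 : ℝ) < n := by exact_mod_cast hn
  have h1 : (25 : ℝ) ≤ Real.exp 5 := by
    have h2 : (2 : ℝ) ≤ Real.exp 1 := by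
      have := Real.add_one_le_exp 1
      linarith
    calc (25 : ℝ) ≤ 2 ^ 5 := by norm_num
      _ ≤ Real.exp 1 ^ 5 := by gcongr
      _ = Real.exp 5 := by rw [← Real.exp_nat_mul]; norm_num
  have h3 : (n : ℝ) ^ 2 ≤ Real.exp (2 * n) := by
    have h4 : (n : ℝ) ≤ Real.exp n := by
      have := Real.add_one_le_exp (n : ℝ)
      linarith
    calc (n : ℝ) ^ 2 ≤ Real.exp n ^ 2 := by gcongr
      _ = Real.exp (2 * n) := by rw [← Real.exp_nat_mul]; norm_num
  have h5 : (25 : ℝ) ^ n ≤ Real.exp (5 * n) := by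
    calc (25 : ℝ) ^ n ≤ Real.exp 5 ^ n := by gcongr
      _ = Real.exp (5 * n) := by rw [← Real.exp_nat_mul, mul_comm]
  calc (25 : ℝ) ^ n * (2 * Real.exp (-(7 * n)))
      ≤ Real.exp (5 * n) * (2 * Real.exp (-(7 * n))) := by gcongr
    _ = 2 * (Real.exp (2 * n))⁻¹ := by
        rw [← Real.exp_neg, mul_left_comm, ← Real.exp_add]
        ring_nf
    _ ≤ 2 * ((n : ℝ) ^ 2)⁻¹ := by gcongr
    _ = _ := by rw [div_eq_mul_inv]

theorem card_mul_moment_bound_le {n : ℕ} (hn : 1 ≤ n) {C : ℝ} (hC : 0 ≤ C) :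
    (n : ℝ) * ((5 / 2 + 10 * (C * Real.log n)) * Real.exp (-(5 * Real.log n)))
      ≤ (5 / 2 + 10 * C) / (n : ℝ) ^ 2 := by
  have hn1 : (1 : ℝ) ≤ n := by exact_mod_cast hn
  have hn0 : (0 : ℝ) < n := by linarith
  have h1 := exp_neg_mul_log hn 5
  push_cast at h1
  rw [h1]
  have h2 : Real.log n ≤ n := Real.log_le_self hn0.le
  have h3 : 5 / 2 + 10 * (C * Real.log n) ≤ (5 / 2 + 10 * C) * n ^ 2 := by
    have h4 : C * Real.log n ≤ C * n := by gcongr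
    have h5 : C * n ≤ C * n ^ 2 := by gcongr; nlinarith
    have h6 : (1 : ℝ) ≤ n ^ 2 := by nlinarith
    nlinarith
  calc (n : ℝ) * ((5 / 2 + 10 * (C * Real.log n)) * (1 / (n : ℝ) ^ 5))
      ≤ (n : ℝ) * (((5 / 2 + 10 * C) * n ^ 2) * (1 / (n : ℝ) ^ 5)) := by gcongr
    _ = _ := by field_simp

open scoped Nat in
/-- With high probability every solution of the semidefinite program is the normalized partnership
matrix of the true clusters. -/
theorem exists_measurableSet_forall_eq_blockMatrix
    {H : Type*} [NormedAddCommGroup H] [InnerProductSpace ℝ H]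
    [MeasurableSpace H] [BorelSpace H] [SecondCountableTopology H]
    {ι : Type*} (e : HilbertBasis ι ℝ H)
    {Ω : Type*} [MeasurableSpace Ω] {P : Measure Ω} [IsProbabilityMeasure P]
    {n K : ℕ} (hK : 1 ≤ K) {σ : Fin n → Fin K} (hσ : Function.Surjective σ)
    {δ : Fin n → Ω → H} (hδ : ∀ i, Measurable (δ i)) (hind : iIndepFun δ P)
    {T : H →L[ℝ] H} (hT : T.IsPositive) {h : ℝ} (h0 : 0 ≤ h)
    (hh : hsNormSq e T ≤ ENNReal.ofReal h) {β : ℝ} (hβ : 0 ≤ β)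
    (hsub : ∀ i z, ∫⁻ ω, ENNReal.ofReal (Real.exp (inner ℝ z (δ i ω))) ∂P
      ≤ ENNReal.ofReal (Real.exp (β * inner ℝ (T z) z / 2)))
    {C : ℝ} (hC : 0 ≤ C) (γ : ℝ)
    (hmom : ∀ i, ∀ q : ℕ, 3 ≤ q → ∫⁻ ω, ENNReal.ofReal (|‖δ i ω‖ ^ 2 - γ| ^ q) ∂P
      ≤ ENNReal.ofReal (C * q ! * (β * ‖T‖) ^ (q - 2) * (β ^ 2 * h)))
    (m : Fin K → H) {Δ : ℝ} (hΔ : 0 < Δ) (hsep : ∀ k l, k ≠ l → Δ ≤ ‖m k - m l‖)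
    {R : ℝ} (hRn : (n : ℝ) ≤ minSize σ * R) (hRlog : Real.log n ≤ R)
    (hsnr : 2 ^ 27 * R * (β * ‖T‖) ≤ Δ ^ 2)
    (hsnr' : 2 ^ 27 * R * (β ^ 2 * h) ≤ minSize σ * Δ ^ 4) :
    ∃ F : Set Ω, MeasurableSet F ∧ ENNReal.ofReal (1 - (9 + 10 * C) / (n : ℝ) ^ 2) ≤ P F ∧
      ∀ ω ∈ F, ∀ Z, IsSDPSolution K (Matrix.gram ℝ fun i => m (σ i) + δ i ω) Z →
        Z = blockMatrix σ := by
  have hn : 1 ≤ n := by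
    obtain ⟨i, -⟩ := hσ ⟨0, hK⟩
    exact Nat.one_le_iff_ne_zero.mpr fun h => by subst h; exact i.elim0
  have hKn : K ≤ n := by simpa using Fintype.card_le_of_surjective σ hσ
  have hn0 : (0 : ℝ) < n := by exact_mod_cast hn
  have hM : (1 : ℝ) ≤ minSize σ := by exact_mod_cast minSize_pos hσ hK
  have hM0 : (0 : ℝ) < minSize σ := by linarith
  have hΛ : 0 ≤ Real.log n := Real.log_natCast_nonneg n
  have hTβ : 0 ≤ β * ‖T‖ := by positivity
  have hhβ : 0 ≤ β ^ 2 * h := by positivity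
  -- `R` dominates `log n` for the polynomially many events (`s1`, `s3`) and `n / minSize` for the
  -- net (`s2`, `s4`).
  have s1 : 2 ^ 27 * Real.log n * (β * ‖T‖) ≤ Δ ^ 2 := le_trans (by gcongr) hsnr
  have s3 : 2 ^ 27 * Real.log n * (β ^ 2 * h) ≤ minSize σ * Δ ^ 4 := le_trans (by gcongr) hsnr'
  have s2 : 2 ^ 27 * n * (β * ‖T‖) ≤ minSize σ * Δ ^ 2 := by
    calc 2 ^ 27 * (n : ℝ) * (β * ‖T‖) ≤ 2 ^ 27 * (minSize σ * R) * (β * ‖T‖) := by gcongr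
      _ = minSize σ * (2 ^ 27 * R * (β * ‖T‖)) := by ring
      _ ≤ _ := by gcongr
  have s4 : 2 ^ 27 * n * (β ^ 2 * h) ≤ (minSize σ : ℝ) ^ 2 * Δ ^ 4 := by
    calc 2 ^ 27 * (n : ℝ) * (β ^ 2 * h) ≤ 2 ^ 27 * (minSize σ * R) * (β ^ 2 * h) := by gcongr
      _ = minSize σ * (2 ^ 27 * R * (β ^ 2 * h)) := by ring
      _ ≤ minSize σ * (minSize σ * Δ ^ 4) := by gcongr
      _ = _ := by ring
  obtain ⟨N, hNcard, hN1, hNnet⟩ := exists_finset_half_net (EuclideanSpace ℝ (Fin n))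
  rw [finrank_euclideanSpace_fin] at hNcard
  set B₁ : Set Ω := ⋃ p ∈ (Finset.univ : Finset (Fin n × Fin K)),
    {ω | ‖m p.2 - m (σ p.1)‖ ^ 2 / 16 < |inner ℝ (δ p.1 ω) (m p.2 - m (σ p.1))|} with hB₁
  set B₂ : Set Ω := ⋃ p ∈ (Finset.univ : Finset (Fin n × Fin n)),
    {ω | Δ ^ 2 / 64 <
      |chaos (fun i => δ i ω) (Pi.single p.1 1) (fun l => blockMatrix σ l p.2)|} with hB₂
  set B₃ : Set Ω := ⋃ p ∈ N ×ˢ N, {ω | minSize σ * Δ ^ 2 / 256 <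
    |chaos (fun i => δ i ω) (fun i => p.1 i) (fun i => p.2 i)|} with hB₃
  set B₄ : Set Ω := ⋃ i ∈ (Finset.univ : Finset (Fin n)),
    {ω | minSize σ * Δ ^ 2 / 64 < |‖δ i ω‖ ^ 2 - γ|} with hB₄
  have hmeas : MeasurableSet (B₁ ∪ B₂ ∪ B₃ ∪ B₄) := by
    refine ((MeasurableSet.union ?_ ?_).union ?_).union ?_
    · refine Finset.measurableSet_biUnion _ fun p _ => ?_
      have := hδ p.1
      exact measurableSet_lt measurable_const (by fun_prop)
    · exact Finset.measurableSet_biUnion _ fun p _ => measurableSet_lt measurable_const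
        (continuous_abs.measurable.comp (measurable_chaos hδ _ _))
    · exact Finset.measurableSet_biUnion _ fun p _ => measurableSet_lt measurable_const
        (continuous_abs.measurable.comp (measurable_chaos hδ _ _))
    · refine Finset.measurableSet_biUnion _ fun i _ => ?_
      have := hδ i
      exact measurableSet_lt measurable_const (by fun_prop)
  have hlog4 : (n : ℝ) ^ 2 * (2 * Real.exp (-(4 * Real.log n))) = 2 / (n : ℝ) ^ 2 := by
    have h1 := exp_neg_mul_log hn 4
    push_cast at h1
    rw [h1]
    field_simp
  have hsmall₁ : P B₁ ≤ ENNReal.ofReal (2 / (n : ℝ) ^ 2) := by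
    rw [← hlog4]
    refine measure_biUnion_finset_le_ofReal _ _ (by positivity) ?_ fun p _ => ?_
    · have h1 : (K : ℝ) ≤ n := by exact_mod_cast hKn
      rw [Finset.card_univ, Fintype.card_prod, Fintype.card_fin, Fintype.card_fin, Nat.cast_mul,
        pow_two]
      gcongr
    -- For equal centres the event reads `0 < 0`; this is why the bad events are defined by strict
    -- inequalities.
    · rcases eq_or_ne p.2 (σ p.1) with hp | hp
      · simp [hp]
      · exact (measure_mono (Set.ofPred_subset_ofPred.mpr fun ω hω => le_of_lt hω)).trans
          (measure_abs_inner_ge_le (hδ p.1) hβ hΛ (hsub p.1) hΔ s1 (hsep _ _ hp))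
  have hsmall₂ : P B₂ ≤ ENNReal.ofReal (2 / (n : ℝ) ^ 2) := by
    rw [← hlog4]
    refine measure_biUnion_finset_le_ofReal _ _ (by positivity) ?_ fun p _ => ?_
    · simp [pow_two]
    · refine (measure_mono (Set.ofPred_subset_ofPred.mpr fun ω hω => le_of_lt hω)).trans
        (measure_abs_chaos_ge_le_of_log e hδ hind hT h0 hh hβ hsub hΛ hΔ hM s1 s3 _ _ ?_)
      have h1 : ∑ i, (Pi.single p.1 1 : Fin n → ℝ) i ^ 2 = 1 := by
        rw [Finset.sum_eq_single p.1]
        · simp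
        · intro j _ hj
          simp [Pi.single_eq_of_ne hj]
        · simp
      rw [h1, one_mul, sum_blockMatrix_sq]
      exact inv_card_cluster_le hσ hK _
  have hsmall₃ : P B₃ ≤ ENNReal.ofReal (2 / (n : ℝ) ^ 2) := by
    refine le_trans (measure_biUnion_finset_le_ofReal (c := 25 ^ n)
      (a := 2 * Real.exp (-(7 * n))) _ _ (by positivity) ?_ fun p hp => ?_)
      (ENNReal.ofReal_le_ofReal (pow_mul_exp_neg_le hn))
    · rw [Finset.card_product]
      calc ((N.card * N.card : ℕ) : ℝ) ≤ ((5 ^ n * 5 ^ n : ℕ) : ℝ) := by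
            exact_mod_cast Nat.mul_le_mul hNcard hNcard
        _ = 25 ^ n := by push_cast; rw [← mul_pow]; norm_num
    · obtain ⟨hp1, hp2⟩ := Finset.mem_product.mp hp
      refine (measure_mono (Set.ofPred_subset_ofPred.mpr fun ω hω => le_of_lt hω)).trans
        (measure_abs_chaos_ge_le_of_card e hδ hind hT h0 hh hβ hsub hΔ hM s2 s4 _ _ ?_)
      have h1 : ∀ x ∈ N, ∑ i, x i ^ 2 ≤ 1 := fun x hx => by
        have h2 := EuclideanSpace.norm_sq_eq x
        simp only [Real.norm_eq_abs, sq_abs] at h2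
        rw [← h2]
        exact pow_le_one₀ (norm_nonneg _) (hN1 x hx)
      exact mul_le_one₀ (h1 _ hp1) (Finset.sum_nonneg fun _ _ => sq_nonneg _) (h1 _ hp2)
  have hsmall₄ : P B₄ ≤ ENNReal.ofReal ((5 / 2 + 10 * C) / (n : ℝ) ^ 2) := by
    refine le_trans (measure_biUnion_finset_le_ofReal (c := n)
      (a := (5 / 2 + 10 * (C * Real.log n)) * Real.exp (-(5 * Real.log n))) _ _ (by positivity) ?_
      fun i _ => ?_) (ENNReal.ofReal_le_ofReal (card_mul_moment_bound_le hn hC))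
    · simp
    · have hδi := hδ i
      exact (measure_mono (Set.ofPred_subset_ofPred.mpr fun ω hω => le_of_lt hω)).trans
        (measure_abs_ge_le_of_bernstein (by fun_prop) hC h0 hβ (hmom i) hΛ hΔ hM s1 s3)
  -- The four numerators add up to `2 + 2 + 2 + 5/2 + 10 C ≤ 9 + 10 C`.
  have hbad : P (B₁ ∪ B₂ ∪ B₃ ∪ B₄) ≤ ENNReal.ofReal ((9 + 10 * C) / (n : ℝ) ^ 2) := by
    refine (measure_union_le _ _).trans ((add_le_add ((measure_union_le _ _).trans
      (add_le_add ((measure_union_le _ _).trans (add_le_add hsmall₁ hsmall₂)) hsmall₃))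
      hsmall₄).trans ?_)
    rw [← ENNReal.ofReal_add (by positivity) (by positivity),
      ← ENNReal.ofReal_add (by positivity) (by positivity),
      ← ENNReal.ofReal_add (by positivity) (by positivity)]
    refine ENNReal.ofReal_le_ofReal ?_
    rw [← add_div, ← add_div, ← add_div]
    exact div_le_div_of_nonneg_right (by linarith) (by positivity)
  refine ⟨(B₁ ∪ B₂ ∪ B₃ ∪ B₄)ᶜ, hmeas.compl, ?_, fun ω hω Z hZ => ?_⟩
  · rw [prob_compl_eq_one_sub hmeas, ENNReal.ofReal_sub _ (by positivity), ENNReal.ofReal_one]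
    exact tsub_le_tsub_left hbad 1
  · simp only [hB₁, hB₂, hB₃, hB₄, Set.compl_union, Set.mem_inter_iff, Set.mem_compl_iff,
      Set.mem_iUnion, Set.mem_ofPred_eq, not_exists, not_lt, Finset.mem_univ, forall_true_left,
      Finset.mem_product, Prod.forall] at hω
    obtain ⟨⟨⟨h1, h2⟩, h3⟩, h4⟩ := hω
    exact eq_blockMatrix_of_bounds hσ hK m (fun i => δ i ω) γ Δ hΔ hsep (N := N) hNnet h1 h2
      (fun x hx y hy => h3 x y ⟨hx, hy⟩) h4 hZ

end Event

/-! ### From the extended-valued signal-to-noise ratio to real inequalities. -/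

section SignalToNoise

variable {H : Type*} [NormedAddCommGroup H] {K : ℕ}

theorem separation_ne_top {m : Fin K → H} (hK : K ≠ 1) (hK1 : 1 ≤ K) : separation m ≠ ∞ := by
  have h : (⟨0, hK1⟩ : Fin K) ≠ ⟨1, by omega⟩ := fun h => by
    have := congr_arg Fin.val h
    simp at this
  refine ne_top_of_le_ne_top (enorm_ne_top (x := m ⟨0, hK1⟩ - m ⟨1, by omega⟩)) ?_
  exact (iInf_le _ _).trans ((iInf_le _ _).trans (iInf_le _ h))

theorem toReal_separation_le {m : Fin K → H} {k l : Fin K} (hkl : k ≠ l) :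
    (separation m).toReal ≤ ‖m k - m l‖ := by
  have h : separation m ≤ ‖m k - m l‖ₑ := (iInf_le _ k).trans ((iInf_le _ l).trans (iInf_le _ hkl))
  rw [← toReal_enorm]
  exact ENNReal.toReal_mono enorm_ne_top h

variable [InnerProductSpace ℝ H] {ι : Type*} {e : HilbertBasis ι ℝ H} {N : ℕ} {Δ a L : ℝ}
  {T : H →L[ℝ] H}

/-- With `Δ = 0` both quotients vanish, even over a zero denominator, by the convention `0 / 0 = 0`.
-/
theorem pos_of_le_snrSq (ha : 0 < a) (hΔ : 0 ≤ Δ)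
    (h : ENNReal.ofReal a ≤ snrSq e N (ENNReal.ofReal Δ) L T) : 0 < Δ := by
  refine lt_of_le_of_ne hΔ fun h0 => ?_
  rw [← h0, snrSq] at h
  simp at h
  linarith

theorem mul_opNorm_le_of_le_snrSq (ha : 0 < a) (hL : 0 ≤ L) (hΔ : 0 ≤ Δ)
    (h : ENNReal.ofReal a ≤ snrSq e N (ENNReal.ofReal Δ) L T) : a * (L ^ 2 * ‖T‖) ≤ Δ ^ 2 := by
  have h1 := ENNReal.mul_le_of_le_div (h.trans (min_le_left _ _))
  rw [← ofReal_norm, ← ENNReal.ofReal_pow hL, ← ENNReal.ofReal_mul (by positivity),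
    ← ENNReal.ofReal_mul ha.le, ← ENNReal.ofReal_pow hΔ] at h1
  exact (ENNReal.ofReal_le_ofReal_iff (by positivity)).mp h1

theorem mul_hsNormSq_le_of_le_snrSq (hL : 0 ≤ L) (hΔ : 0 ≤ Δ)
    (h : ENNReal.ofReal a ≤ snrSq e N (ENNReal.ofReal Δ) L T) :
    ENNReal.ofReal a * (ENNReal.ofReal (L ^ 4) * hsNormSq e T) ≤ ENNReal.ofReal (N * Δ ^ 4) := by
  have h1 := ENNReal.mul_le_of_le_div (h.trans (min_le_right _ _))
  rwa [← ENNReal.ofReal_pow hL, ← ENNReal.ofReal_pow hΔ, ← ENNReal.ofReal_natCast,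
    ← ENNReal.ofReal_mul (Nat.cast_nonneg _)] at h1

/-- The signal-to-noise condition in terms of real numbers. If `L = 0`, the operator has to be
replaced by `0`, since it need not be Hilbert-Schmidt. -/
theorem exists_dominating_operator (ha : 0 < a) (hL : 0 ≤ L) (hΔ : 0 ≤ Δ)
    (h : ENNReal.ofReal a ≤ snrSq e N (ENNReal.ofReal Δ) L T)
    {S : Fin K → H →L[ℝ] H} (hS : ∀ k, (S k).IsPositive) (hST : ∀ k, (T - S k).IsPositive)
    (hSL : ∀ k, S k = 0 ∨ 1 ≤ L) (hK : 1 ≤ K) :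
    ∃ (T' : H →L[ℝ] H) (v : ℝ), T'.IsPositive ∧ (∀ k, (T' - S k).IsPositive) ∧ 0 ≤ v ∧
      hsNormSq e T' ≤ ENNReal.ofReal v ∧ a * (L ^ 2 * ‖T'‖) ≤ Δ ^ 2 ∧
      a * ((L ^ 2) ^ 2 * v) ≤ N * Δ ^ 4 := by
  rcases eq_or_ne L 0 with rfl | hL0
  · have hS0 : ∀ k, S k = 0 := fun k => (hSL k).resolve_right (by norm_num)
    refine ⟨0, 0, ContinuousLinearMap.isPositive_zero, fun k => ?_, le_rfl, ?_, ?_, ?_⟩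
    · rw [hS0, sub_zero]
      exact ContinuousLinearMap.isPositive_zero
    · simp [hsNormSq]
    · simp [sq_nonneg]
    · simp only [mul_zero]
      positivity
  · have hLpos : 0 < L := lt_of_le_of_ne hL (Ne.symm hL0)
    have h1 := mul_hsNormSq_le_of_le_snrSq hL hΔ h
    have hT : T.IsPositive := by simpa using (hST ⟨0, hK⟩).add (hS ⟨0, hK⟩)
    -- For `L > 0` an infinite Hilbert-Schmidt norm would make the left side of `h1` infinite and
    -- the right side finite.
    have hfin : hsNormSq e T ≠ ∞ := by
      intro htop
      rw [htop, ENNReal.mul_top (by simpa using pow_pos hLpos 4), ENNReal.mul_top (by simpa using ha)]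
        at h1
      exact ENNReal.ofReal_ne_top (top_le_iff.mp h1)
    refine ⟨T, (hsNormSq e T).toReal, hT, hST, ENNReal.toReal_nonneg,
      (ENNReal.ofReal_toReal hfin).ge, mul_opNorm_le_of_le_snrSq ha hL hΔ h, ?_⟩
    rw [← ENNReal.ofReal_toReal hfin, ← ENNReal.ofReal_mul (by positivity),
      ← ENNReal.ofReal_mul ha.le] at h1
    rw [← pow_mul]
    exact (ENNReal.ofReal_le_ofReal_iff (by positivity)).mp h1

end SignalToNoise

/-! ### Transfer of the assumptions to the dominating operator. -/

section Observations

variable {H : Type*} [NormedAddCommGroup H] [InnerProductSpace ℝ H] {ι : Type*}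
  {e : HilbertBasis ι ℝ H} {Ω : Type*} [MeasurableSpace Ω] {P : Measure Ω} {Z : Ω → H}
  {S T : H →L[ℝ] H} {L : ℝ}

theorem SubGaussianBound.mono {α : ℝ} (h : SubGaussianBound P Z S α) (hα : 0 ≤ α) (hαL : α ≤ L)
    (hS : S.IsPositive) (hST : (T - S).IsPositive) : SubGaussianBound P Z T L := by
  intro z
  refine (h z).trans (ENNReal.ofReal_le_ofReal (Real.exp_le_exp.mpr ?_))
  have h1 := hS.inner_nonneg_left z
  have h2 := hST.inner_nonneg_left z
  rw [_root_.sub_apply, inner_sub_left] at h2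
  have h3 : inner ℝ (S z) z ≤ inner ℝ (T z) z := by linarith
  gcongr

-- If `S ≠ 0` then `L ≥ 1`, so the `ψ₂` norm is at most `L²` and `v ≤ L⁴ v`; this puts the moments
-- on the scale `β = L²` of the chaos bounds.
open scoped Nat in
theorem BernsteinSqNorm.moment_le {C v : ℝ} (h : BernsteinSqNorm e C P Z S) (hC : 0 ≤ C)
    (hL : psi2Norm P Z S ≤ L) (hS : S.IsPositive) (hST : (T - S).IsPositive)
    (hSL : S = 0 ∨ 1 ≤ L) (hv : 0 ≤ v) (hT : hsNormSq e T ≤ ENNReal.ofReal v)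
    {q : ℕ} (hq : 3 ≤ q) :
    ∫⁻ ω, ENNReal.ofReal
        (|‖Z ω - ∫ ω', Z ω' ∂P‖ ^ 2 - ∫ ω'', ‖Z ω'' - ∫ ω', Z ω' ∂P‖ ^ 2 ∂P| ^ q) ∂P
      ≤ ENNReal.ofReal (C * q ! * (L ^ 2 * ‖T‖) ^ (q - 2) * ((L ^ 2) ^ 2 * v)) := by
  refine (h q hq).trans ?_
  rcases hSL with rfl | hL1
  · simp [hsNormSq]
  · have hψ := psi2Norm_nonneg P Z S
    refine (mul_le_mul_right ((hsNormSq_le_of_isPositive_sub e hS hST).trans hT) _).trans ?_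
    rw [← ENNReal.ofReal_mul (by positivity)]
    refine ENNReal.ofReal_le_ofReal ?_
    have h1 : psi2Norm P Z S ≤ L ^ 2 := hL.trans (by nlinarith)
    have h2 := opNorm_le_of_isPositive_sub hS hST
    have h3 : v ≤ (L ^ 2) ^ 2 * v := by
      refine le_mul_of_one_le_left hv ?_
      rw [← pow_mul]
      exact one_le_pow₀ hL1
    calc C * q ! * psi2Norm P Z S ^ (q - 2) * ‖S‖ ^ (q - 2) * v
        ≤ C * q ! * (L ^ 2) ^ (q - 2) * ‖T‖ ^ (q - 2) * ((L ^ 2) ^ 2 * v) := by gcongr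
      _ = _ := by rw [mul_pow]; ring

theorem one_le_of_covOp_ne_zero [CompleteSpace H] [TopologicalSpace.SeparableSpace H]
    [MeasurableSpace H] [BorelSpace H] [IsProbabilityMeasure P] (hZ : Measurable Z)
    (hZ2 : MemLp Z 2 P) (hS : covOp P Z = S) (hpos : S.IsPositive) (hsub : IsSubGaussian P Z S)
    (hL : psi2Norm P Z S ≤ L) : S = 0 ∨ 1 ≤ L := by
  subst hS
  rcases covOp_eq_zero_or_one_le hZ hZ2 hpos (psi2Norm_nonneg _ _ _)
    (subGaussianBound_psi2Norm hsub) with h | h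
  · exact Or.inl h
  · exact Or.inr (h.trans hL)

end Observations

end KMeansSDP

end

/-! ### Assembly. -/

open KMeansSDP in
theorem corollary3p2 (C_B : ℝ) (hC_B : 0 < C_B) :
    ∃ c₁ > (0 : ℝ), ∃ c₂ > (0 : ℝ), ∃ C > (0 : ℝ),
      ∀ (H : Type*) [NormedAddCommGroup H] [InnerProductSpace ℝ H] [CompleteSpace H]
        [TopologicalSpace.SeparableSpace H] [MeasurableSpace H] [BorelSpace H]
        (ι : Type*) (e : HilbertBasis ι ℝ H)
        (Ω : Type*) [MeasurableSpace Ω] (P : Measure Ω) [IsProbabilityMeasure P]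
        (n K : ℕ) (_ : 1 ≤ K)
        -- the true clusters, all of them non-empty, are the fibres of `σ`
        (σ : Fin n → Fin K) (_ : Function.Surjective σ)
        -- independent observations, with law `law k` on the cluster `k`
        (X : Fin n → Ω → H) (_ : ∀ i, Measurable (X i)) (_ : iIndepFun X P)
        (law : Fin K → Measure H) (_ : ∀ i, P.map (X i) = law (σ i))
        -- means and covariance operators of the clusters
        (_ : ∀ i, MemLp (X i) 2 P)
        (m : Fin K → H) (_ : ∀ i, ∫ ω, X i ω ∂P = m (σ i))
        (S : Fin K → H →L[ℝ] H) (_ : ∀ i, KMeansSDP.covOp P (X i) = S (σ i))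
        (_ : ∀ k, KMeansSDP.IsPositiveTraceClass e (S k))
        (_ : ∀ k l, KMeansSDP.posTraceNorm e (S k) = KMeansSDP.posTraceNorm e (S l))
        -- sub-gaussianity and the Bernstein condition
        (L : ℝ)
        (_ : ∀ i, KMeansSDP.IsSubGaussian P (X i) (S (σ i)))
        (_ : ∀ i, KMeansSDP.psi2Norm P (X i) (S (σ i)) ≤ L)
        (_ : ∀ i, KMeansSDP.BernsteinSqNorm e C_B P (X i) (S (σ i)))
        -- an operator dominating all covariance operators
        (Sig : H →L[ℝ] H) (_ : ∀ k, (Sig - S k).IsPositive)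
        -- the signal-to-noise condition and the size condition
        (_ : ENNReal.ofReal
              (c₁ * max ((n : ℝ) / (KMeansSDP.minSize σ : ℝ)) (Real.log (n : ℝ)))
            ≤ KMeansSDP.snrSq e (KMeansSDP.minSize σ) (KMeansSDP.separation m) L Sig)
        (_ : c₂ * (n : ℝ) ≤ (KMeansSDP.minSize σ : ℝ) ^ 2 * (K : ℝ)),
        -- exact recovery, up to a non-random relabelling of the true clusters
        ∃ π : Equiv.Perm (Fin K),
          ∀ Zhat : Ω → Matrix (Fin n) (Fin n) ℝ,
            (∀ ω, KMeansSDP.IsSDPSolution K (Matrix.gram ℝ fun i => X i ω) (Zhat ω)) →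
            KMeansSDP.HoldsWithProb P (1 - C / (n : ℝ) ^ 2)
              {ω | KMeansSDP.RoundsTo (Zhat ω) fun k => KMeansSDP.cluster σ (π k)} := by
  -- `2 ^ 27` is the factor demanded by the tail bounds, and `9 + 10 * C_B` collects the four
  -- failure probabilities.
  refine ⟨2 ^ 27, by norm_num, 1, one_pos, 9 + 10 * C_B, by positivity, ?_⟩
  intro H _ _ _ _ _ _ ι e Ω _ P _ n K hK σ hσ X hX hind law _ hX2 m hm S hS hStr htr L hsub hψ hBern
    Sig hSig hsnr _
  obtain ⟨π, hπ⟩ := exists_perm_roundsTo_blockMatrix hσ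
  refine ⟨π, fun Zhat hZhat => ?_⟩
  suffices hF : ∃ F : Set Ω, MeasurableSet F ∧
      ENNReal.ofReal (1 - (9 + 10 * C_B) / (n : ℝ) ^ 2) ≤ P F ∧
      ∀ ω ∈ F, Zhat ω = blockMatrix σ by
    obtain ⟨F, hFm, hFP, hFZ⟩ := hF
    refine ⟨F, hFm, fun ω hω => ?_, hFP⟩
    change RoundsTo (Zhat ω) _
    rw [hFZ ω hω]
    exact hπ
  have hSpos : ∀ k, (S k).IsPositive := fun k => (hStr k).1
  -- With one cluster the separation is infinite and no off-cluster pairs exist, so the block matrix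
  -- is the only feasible point.
  rcases eq_or_ne K 1 with rfl | hK1
  · refine ⟨Set.univ, MeasurableSet.univ, ?_, fun ω _ => ?_⟩
    · rw [measure_univ, ← ENNReal.ofReal_one]
      refine ENNReal.ofReal_le_ofReal ?_
      have : 0 ≤ (9 + 10 * C_B) / (n : ℝ) ^ 2 := by positivity
      linarith
    · refine eq_blockMatrix_of_offMass_nonpos hσ hK (hZhat ω).1 (le_of_eq ?_)
      exact Finset.sum_eq_zero fun i _ => Finset.sum_eq_zero fun j _ =>
        if_pos (Subsingleton.elim _ _)
  have : SecondCountableTopology H := UniformSpace.secondCountable_of_separable H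
  obtain ⟨i₀, -⟩ := hσ ⟨0, hK⟩
  have hn0 : (0 : ℝ) < n := Nat.cast_pos.mpr (i₀.pos)
  have hM0 : (0 : ℝ) < minSize σ := Nat.cast_pos.mpr (minSize_pos hσ hK)
  set R := max ((n : ℝ) / (minSize σ : ℝ)) (Real.log (n : ℝ)) with hR
  have hRpos : 0 < R := lt_of_lt_of_le (by positivity) (le_max_left _ _)
  have hL : 0 ≤ L := (psi2Norm_nonneg _ _ _).trans (hψ i₀)
  rw [← ENNReal.ofReal_toReal (separation_ne_top (m := m) hK1 hK)] at hsnr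
  set Δ := (separation m).toReal with hΔdef
  have hΔ : 0 < Δ := pos_of_le_snrSq (by positivity) ENNReal.toReal_nonneg hsnr
  have hSL : ∀ i, S (σ i) = 0 ∨ 1 ≤ L := fun i =>
    one_le_of_covOp_ne_zero (hX i) (hX2 i) (hS i) (hSpos _) (hsub i) (hψ i)
  have hSL' : ∀ k, S k = 0 ∨ 1 ≤ L := fun k => by
    obtain ⟨i, rfl⟩ := hσ k
    exact hSL i
  obtain ⟨T, v, hT, hTS, hv, hTv, hsnr₁, hsnr₂⟩ :=
    exists_dominating_operator (by positivity) hL hΔ.le hsnr hSpos hSig hSL' hK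
  have hγ : ∀ i, ∫ ω, ‖X i ω - m (σ i)‖ ^ 2 ∂P = (posTraceNorm e (S (σ i₀))).toReal := fun i => by
    rw [← hm i, integral_norm_sq_eq_posTraceNorm e (hX i) (hX2 i), hS, htr (σ i) (σ i₀)]
  obtain ⟨F, hFm, hFP, hFZ⟩ := exists_measurableSet_forall_eq_blockMatrix e hK hσ
    (δ := fun i ω => X i ω - m (σ i)) (fun i => (hX i).sub_const _)
    (hind.comp (fun i x => x - m (σ i)) fun i => measurable_id.sub_const _) hT hv hTv (sq_nonneg L)
    (fun i z => by
      have h1 := (subGaussianBound_psi2Norm (hsub i)).mono (psi2Norm_nonneg _ _ _) (hψ i)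
        (hSpos _) (hTS _) z
      rwa [hm i] at h1)
    hC_B.le (posTraceNorm e (S (σ i₀))).toReal
    (fun i q hq => by
      have h1 := (hBern i).moment_le hC_B.le (hψ i) (hSpos _) (hTS _) (hSL i) hv hTv hq
      rwa [hm i, hγ i] at h1)
    m hΔ (fun k l hkl => toReal_separation_le hkl) (R := R)
    (by rw [mul_comm, ← div_le_iff₀ hM0]; exact le_max_left _ _) (le_max_right _ _) hsnr₁ hsnr₂
  refine ⟨F, hFm, hFP, fun ω hω => hFZ ω hω _ ?_⟩
  simpa using hZhat ω
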